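/- **Setting.** Let $\mathbb K$ be a field of characteristic $0$ and $\mathcal H=\bigoplus_{n\ge 0}\mathcal H^{(n)}$ a connected graded commutative $\mathbb K$-bialgebra (hence a Hopf algebra) with coproduct $\Delta$ and counit $\epsilon$, for instance the Connes–Kreimer Hopf algebra $\mathcal H_{\mathcal F}$ of Feynman graphs, graded by loop number. Let $A$ be a commutative unital $\mathbb K$-algebra and $R:A\to A$ an idempotent linear map with $R(x)R(y)=R\big(R(x)y+xR(y)-xy\big)$ for all $x,y$ (a Rota–Baxter map of weight one); put $\tilde R=\mathrm{id}-R$. Let $\mathcal A=\mathrm{Hom}(\mathcal H,A)$ with the convolution product $\star$, unit $e_A=\eta_A\circ\epsilon$, filtration $\mathcal A_n=\{f: f(\mathcal H^{(k)})=0 \text{ for } k\le n-1\}$ and operators $\mathcal R(f)=R\circ f$, $\tilde{\mathcal R}=\mathrm{id}-\mathcal R$. Limits in $\mathcal A$ are taken in the topology of the filtration; $\exp^\star$ and $\log^\star$ are the usual power series for $\star$ on $\mathcal A_1$ and $e_A+\mathcal A_1$; $\mathrm{BCH}(x,y)=\log^\star(\exp^\star(x)\star\exp^\star(y))-x-y$;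 for $u\in\mathcal A_1$, $\chi(u)=\lim_n\chi_{(n)}(u)$ with $\chi_{(0)}(u)=u$ and $\chi_{(n+1)}(u)=u-\mathrm{BCH}\big(\mathcal R(\chi_{(n)}(u)),\tilde{\mathcal R}(\chi_{(n)}(u))\big)$. Characters are unital algebra morphisms $\mathcal H\to A$. The double product is $f\star_{\mathcal R}g=\mathcal R(f)\star g+f\star\mathcal R(g)-f\star g$, and $\exp^{\star_{\mathcal R}}(f)=e_A+\sum_{n\ge1}f^{\star_{\mathcal R}n}/n!$. For $\Gamma\in\mathcal H$ write $\Delta(\Gamma)=\Gamma\otimes1+1\otimes\Gamma+\sum\Gamma'\otimes\Gamma''$ (for a one-particle irreducible Feynman graph, $\sum\Gamma'\otimes\Gamma''=\sum_{\gamma\subset\Gamma}\gamma\otimes\Gamma/\gamma$). **Theorem.** $(\mathcal A,\mathcal R)$ with the filtration $(\mathcal A_n)$ is a complete filtered Rota–Baxter algebra of weight one with idempotent, filtration preserving Rota–Baxter map. Let $\phi$ be an $A$-valued character, $a=\phi-e_A$ and $b=\log^\star(\phi)$. Then $a\in\mathcal A_1$, $\phi$ is $\star$-invertible, $b$ is an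 infinitesimal character and the unique element of $\mathcal A_1$ with $\exp^\star(b)=\phi$, and the recursion converges to an element $\chi(b)\in\mathcal A_1$ with $\chi(b)=b-\mathrm{BCH}\big(\mathcal R(\chi(b)),\tilde{\mathcal R}(\chi(b))\big)$. Moreover: 1. Each of the equations $X=e_A-\mathcal R(X\star a)$ and $Y=e_A-\tilde{\mathcal R}(a\star Y)$ has a unique solution in $\mathcal A$; with $\phi_-:=X$, $Y$ is an invertible character and with $\phi_+:=Y^{-1}$ one has $\phi_+=\phi_-\star\phi$ and $\phi_+=e_A-\tilde{\mathcal R}\big(\phi_+\star(\phi^{-1}-e_A)\big)$. For $\Gamma\in\ker\epsilon$, $$\phi_-(\Gamma)=-R\Big(\phi(\Gamma)+\sum\phi_-(\Gamma')\phi(\Gamma'')\Big),\qquad \phi_+(\Gamma)=\tilde R\Big(\phi(\Gamma)+\sum\phi_-(\Gamma')\phi(\Gamma'')\Big).$$ 2. $\phi_-=\sum_{n\ge0}(-1)^n\,\mathcal R(\mathcal R(\cdots\mathcal R(a)\star a\cdots)\star a)$ and $\phi_+^{-1}=\sum_{n\ge0}(-1)^n\,\tilde{\mathcal R}(a\star\tilde{\mathcal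 R}(a\star\cdots\tilde{\mathcal R}(a)\cdots))$ ($n$ factors $a$ in the $n$-th term), and $$\phi_-=\exp^\star\big(-\mathcal R(\chi(b))\big),\qquad \phi_+=\exp^\star\big(\tilde{\mathcal R}(\chi(b))\big).$$ Both $\phi_-$ and $\phi_+$ are characters, $\phi_-\in e_A+\mathcal R(\mathcal A_1)$ and $\phi_+\in e_A+\tilde{\mathcal R}(\mathcal A_1)$. 3. $\phi=\exp^\star\big(\mathcal R(\chi(b))\big)\star\exp^\star\big(\tilde{\mathcal R}(\chi(b))\big)=\phi_-^{-1}\star\phi_+$, and $(\phi_-,\phi_+)$ is the only pair $(\psi_-,\psi_+)$ with $\psi_-\in e_A+\mathcal R(\mathcal A_1)$, $\psi_+\in e_A+\tilde{\mathcal R}(\mathcal A_1)$ and $\phi=\psi_-^{-1}\star\psi_+$. 4. Bogoliubov's map $\bar{\mathrm R}[\phi](\Gamma):=\phi(\Gamma)+\sum\phi_-(\Gamma')\phi(\Gamma'')$ satisfies $\bar{\mathrm R}[\phi]=\phi_-\star(\phi-e_A)=e_A-\exp^{\star_{\mathcal R}}\big(-\chi(\log^\star\phi)\big)$; in particular $\bar{\mathrm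 R}[\phi]=-\exp^{\star_{\mathcal R}}\big(-\chi(\log^\star\phi)\big)$ on $\ker\epsilon$. Furthermore $\mathcal R(\bar{\mathrm R}[\phi])=e_A-\phi_-$ and $\tilde{\mathcal R}(\bar{\mathrm R}[\phi])=\phi_+-e_A$. With $E=\exp^{\star_{\mathcal R}}\big(-\chi(\log^\star\phi)\big)$, the equalities $\mathcal R(E)=\phi_--e_A$ and $\tilde{\mathcal R}(E)=2e_A-\phi_+$ hold on $\ker\epsilon$, and on all of $\mathcal H$ if $R(1_A)=0$. -/

import Mathlib

open scoped TensorProduct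

noncomputable section

namespace RotaBaxterRenorm

/-! ### Complete filtered algebras, exponential, logarithm, BCH-recursion -/

section Filtered

variable {K B : Type*} [Field K] [Ring B] [Algebra K B]

/-- A decreasing algebra filtration `F 0 ⊇ F 1 ⊇ …` exhausting `B`
(for a decreasing filtration this means `F 0 = B`), which is separated and complete. -/
structure IsCompleteFiltered (F : ℕ → Submodule K B) : Prop where
  zero_eq_top : F 0 = ⊤
  antitone : ∀ n, F (n + 1) ≤ F n
  mul_mem : ∀ m n x y, x ∈ F m → y ∈ F n → x * y ∈ F (m + n)
  separated : ∀ x, (∀ n, x ∈ F n) → x = 0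
  complete : ∀ u : ℕ → B, (∀ n, ∃ N, ∀ p ≥ N, ∀ q ≥ N, u p - u q ∈ F n) →
    ∃ L, ∀ n, ∃ N, ∀ p ≥ N, u p - L ∈ F n

/-- `L` is a limit of the sequence `u` in the topology given by the filtration. -/
def IsFilLimit (F : ℕ → Submodule K B) (u : ℕ → B) (L : B) : Prop :=
  ∀ n, ∃ N, ∀ p ≥ N, u p - L ∈ F n

open Classical in
/-- The limit of `u` in the topology given by the filtration (`0` if there is none). -/
def filLim (F : ℕ → Submodule K B) (u : ℕ → B) : B :=
  if h : ∃ L, IsFilLimit F u L then h.choose else 0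

/-- `exp a = ∑_{n ≥ 0} a ^ n / n!`. -/
def filExp (F : ℕ → Submodule K B) (a : B) : B :=
  filLim F fun N => ∑ n ∈ Finset.range N, ((n.factorial : K)⁻¹) • a ^ n

/-- `log y = - ∑_{n ≥ 1} (-(y - 1)) ^ n / n`. -/
def filLog (F : ℕ → Submodule K B) (y : B) : B :=
  filLim F fun N => -∑ n ∈ Finset.range N, (((n + 1 : ℕ) : K)⁻¹) • (-(y - 1)) ^ (n + 1)

/-- `BCH(x, y)`, determined by `exp x * exp y = exp (x + y + BCH(x, y))`. -/
def filBCH (F : ℕ → Submodule K B) (x y : B) : B :=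
  filLog F (filExp F x * filExp F y) - x - y

/-- The approximations of the BCH-recursion of a linear map `P`:
`χ₀(a) = a`, `χₙ₊₁(a) = a - BCH(P(χₙ(a)), (id - P)(χₙ(a)))`. -/
def chiApprox (F : ℕ → Submodule K B) (P : B →ₗ[K] B) (a : B) : ℕ → B
  | 0 => a
  | n + 1 => a - filBCH F (P (chiApprox F P a n)) (chiApprox F P a n - P (chiApprox F P a n))

/-- The BCH-recursion `χ(a) = lim χₙ(a)`. -/
def chi (F : ℕ → Submodule K B) (P : B →ₗ[K] B) (a : B) : B :=
  filLim F (chiApprox F P a)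

/-- The Rota–Baxter relation of weight `θ`. -/
def IsRotaBaxter (θ : K) (R : B →ₗ[K] B) : Prop :=
  ∀ x y, R x * R y = R (R x * y + x * R y - θ • (x * y))

/-- A complete filtered algebra with a filtration preserving Rota–Baxter map of weight `θ`. -/
structure IsCompleteFilteredRotaBaxter (θ : K) (F : ℕ → Submodule K B) (R : B →ₗ[K] B) :
    Prop where
  completeFiltered : IsCompleteFiltered F
  rotaBaxter : IsRotaBaxter θ R
  map_mem : ∀ n x, x ∈ F n → R x ∈ F n

/-- The double Rota–Baxter product (weight one). -/
def doubleMul (R : B →ₗ[K] B) (x y : B) : B := R x * y + x * R y - x * y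

/-- `doublePow R x n` is the `(n + 1)`-st power of `x` for the double product. -/
def doublePow (R : B →ₗ[K] B) (x : B) : ℕ → B
  | 0 => x
  | n + 1 => doubleMul R (doublePow R x n) x

/-- The exponential for the double product, with the unit of `B` as term of order zero:
`1 + ∑_{n ≥ 1} x ^ {*_R n} / n!`. -/
def doubleExp (F : ℕ → Submodule K B) (R : B →ₗ[K] B) (x : B) : B :=
  1 + filLim F fun N => ∑ n ∈ Finset.range N, (((n + 1).factorial : K)⁻¹) • doublePow R x n

/-- `leftIter R a n = R(R(⋯R(R(a) a)⋯ a) a)` with `n` occurrences of `a`. -/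
def leftIter (R : B →ₗ[K] B) (a : B) : ℕ → B
  | 0 => 1
  | n + 1 => R (leftIter R a n * a)

/-- `rightIter R a n = R(a R(a ⋯ R(a R(a))⋯))` with `n` occurrences of `a`. -/
def rightIter (R : B →ₗ[K] B) (a : B) : ℕ → B
  | 0 => 1
  | n + 1 => R (a * rightIter R a n)

/-- The set `1 + R(F 1)`. -/
def oneAddRange (F : ℕ → Submodule K B) (R : B →ₗ[K] B) : Set B :=
  {y | ∃ u ∈ F 1, y = 1 + R u}

end Filtered

/-! ### Connected graded bialgebras and their convolution algebras -/

section Hopf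

variable {K H A : Type*} [Field K] [CommRing H] [Bialgebra K H] [CommRing A] [Algebra K A]

/-- The algebra grading `G` makes `H` a connected graded bialgebra:
`Δ(G n) ⊆ ⨁_{p + q = n} G p ⊗ G q` and `G 0 = K · 1`. -/
structure IsConnectedGradedBialgebra (G : ℕ → Submodule K H) [GradedAlgebra G] : Prop where
  comul_mem : ∀ n, ∀ x ∈ G n, (Coalgebra.comul x : H ⊗[K] H) ∈
    ⨆ pq ∈ Finset.HasAntidiagonal.antidiagonal n, LinearMap.range (TensorProduct.mapIncl (G pq.1) (G pq.2))
  connected : G 0 = 1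

variable (K H A) in
/-- `Hom(H, A)`, with the convolution product and the unit `η_A ∘ ε`. -/
abbrev ConvHom := WithConv (H →ₗ[K] A)

variable (A) in
/-- `Hom(H, A)_n`: the maps that vanish in all degrees `k ≤ n - 1`. -/
def homFil (G : ℕ → Submodule K H) (n : ℕ) : Submodule K (ConvHom K H A) where
  carrier := {f | ∀ k < n, ∀ x ∈ G k, f x = 0}
  add_mem' {f g} hf hg k hk x hx := by
    change f x + g x = 0
    rw [hf k hk x hx, hg k hk x hx, add_zero]
  zero_mem' _ _ _ _ := rfl
  smul_mem' c f hf k hk x hx := by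
    change c • f x = 0
    rw [hf k hk x hx, smul_zero]

variable (H) in
/-- The operator `f ↦ R ∘ f` on `Hom(H, A)`. -/
def postComp (R : A →ₗ[K] A) : ConvHom K H A →ₗ[K] ConvHom K H A where
  toFun f := WithConv.toConv (R ∘ₗ f.ofConv)
  map_add' f g := by ext x; exact map_add R _ _
  map_smul' c f := by ext x; exact map_smul R _ _

/-- `A`-valued characters: (unital) algebra morphisms. -/
def IsCharacter (f : ConvHom K H A) : Prop :=
  f 1 = 1 ∧ ∀ x y, f (x * y) = f x * f y

/-- `A`-valued infinitesimal characters. -/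
def IsInfinitesimalCharacter (Z : ConvHom K H A) : Prop :=
  ∀ x y, Z (x * y) = algebraMap K A (Coalgebra.counit x) * Z y
    + Z x * algebraMap K A (Coalgebra.counit y)

variable (K H) in
/-- The reduced coproduct `x ↦ Δ(x) - x ⊗ 1 - 1 ⊗ x`. -/
def reducedComul : H →ₗ[K] H ⊗[K] H :=
  Coalgebra.comul - (TensorProduct.mk K H H).flip 1 - TensorProduct.mk K H H 1

/-- Bogoliubov's preparation map `Γ ↦ φ(Γ) + ∑ ψ(Γ') φ(Γ'')` of `φ` with counterterm `ψ`, the sum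
being over the reduced coproduct `∑ Γ' ⊗ Γ''` of `Γ`. -/
def barMap (ψ φ : ConvHom K H A) : ConvHom K H A :=
  WithConv.toConv (φ.ofConv +
    LinearMap.mul' K A ∘ₗ TensorProduct.map ψ.ofConv φ.ofConv ∘ₗ reducedComul K H)

end Hopf

end RotaBaxterRenorm

end

noncomputable section

namespace RotaBaxterRenorm

/-! ### Formal identity `exp (log (1 + X)) = 1 + X` -/

section FormalExpLog

open PowerSeries

/-! Write `b = log φ` and `c = χ(b)`. The higher-order part of BCH is contracting for the
filtration, so the recursion converges. Its fixed-point equation says exactly `φ = exp(R c) * exp(c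
- R c)` (`filExp_eq_mul_filExp_chi`); this holds for any filtration preserving linear map.

The Rota–Baxter relation enters through the double product, for which both `R` and `-(id - R)` are
multiplicative. Hence the double exponential series without its unit sums to `exp(R x) - exp(-(x - R
x))`, and `R` sends it to `exp(R x) - 1` (Spitzer, `map_filExp_sub_filExp`). Taking `x = -c` and `x
= c` shows that `exp(-R c)` and `exp(-(c - R c))` solve the two Atkinson equations. Multiplication
by `φ - 1` raises the filtration degree, so the solutions are unique and equal to the iterated
series. Idempotence of `R` turns any Birkhoff pair into a solution of the first equation, which
gives uniqueness of the factorization.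

For the character property, `exp` and `log` exchange infinitesimal characters and characters: at a
fixed element, `exp(t Z)` is polynomial in `t`, so multiplicativity becomes an identity of
polynomials. Composition with `R` preserves infinitesimal characters, hence `c`, `R c` and `c - R c`
are infinitesimal. -/

theorem one_add_X_mul_derivative_log (K : Type*) [CommRing K] [Algebra ℚ K] :
    (1 + X) * d⁄dX K (PowerSeries.log K) = 1 := by
  rw [deriv_log]
  ext n
  cases n with
  | zero => simp [add_mul]
  | succ n => simp [add_mul, coeff_succ_X_mul, coeff_one, pow_succ]

/-- The composite `f` satisfies `(1 + X) f' = f` with `f(0) = 1`. Comparing coefficients gives `(n +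
2) f_{n+2} = -n f_{n+1}`, which forces `f_1 = 1` and kills everything above. -/
theorem exp_subst_log (K : Type*) [Field K] [Algebra ℚ K] :
    (PowerSeries.exp K).subst (PowerSeries.log K) = 1 + (X : PowerSeries K) := by
  have : CharZero K := algebraRat.charZero K
  set f := (PowerSeries.exp K).subst (PowerSeries.log K) with hf
  have hd : (1 + X) * d⁄dX K f = f := by
    rw [hf, derivative_subst HasSubst.log, derivative_exp, ← hf, mul_left_comm,
      one_add_X_mul_derivative_log, mul_one]
  have h0 : coeff 0 f = 1 := by
    rw [hf, coeff_subst' HasSubst.log, finsum_eq_single _ 0]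
    · simp
    · intro d hd
      simp [hd]
  have hrec : ∀ n, coeff (n + 2) f * ((n : K) + 2) + coeff (n + 1) f * (n + 1)
      = coeff (n + 1) f := by
    intro n
    have := congrArg (coeff (n + 1)) hd
    simp only [add_mul, one_mul, map_add, coeff_succ_X_mul, coeff_derivative] at this
    push_cast at this
    linear_combination this
  have h1 : coeff 1 f = 1 := by
    have := congrArg (coeff 0) hd
    rw [add_mul, one_mul, map_add, coeff_zero_X_mul, coeff_derivative, h0] at this
    simpa using this
  have h2 : ∀ n, coeff (n + 2) f = 0 := by
    intro n
    induction n with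
    | zero =>
      have := hrec 0
      simp only [Nat.cast_zero, zero_add, mul_one, add_eq_right] at this
      simpa using this
    | succ n ih =>
      have := hrec (n + 1)
      rw [show n + 1 + 1 = n + 2 from rfl, ih, zero_mul, add_zero] at this
      refine (mul_eq_zero.1 this).resolve_right ?_
      exact_mod_cast (Nat.succ_ne_zero (n + 2))
  ext n
  match n with
  | 0 => simp [h0]
  | 1 => simp [h1, coeff_one]
  | n + 2 => simp [h2, coeff_one, coeff_X]

end FormalExpLog

/-! ### Power series in complete filtered algebras -/

section Filtered

variable {K B : Type*} [Field K] [Ring B] [Algebra K B] {F : ℕ → Submodule K B}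

/-- The value `∑ pₙ xⁿ` of a power series `p` at an element `x` of a filtered algebra. -/
def filEval (F : ℕ → Submodule K B) (p : PowerSeries K) (x : B) : B :=
  filLim F fun N => ∑ n ∈ Finset.range N, PowerSeries.coeff n p • x ^ n

theorem filEval_smul (p : PowerSeries K) (c : K) {x : B} :
    filEval F p (c • x) = filEval F (PowerSeries.rescale c p) x := by
  unfold filEval
  congr 1
  funext N
  refine Finset.sum_congr rfl fun n _ => ?_
  rw [smul_pow, PowerSeries.coeff_rescale, smul_smul, mul_comm]

theorem IsFilLimit.map {u : ℕ → B} {L : B} (h : IsFilLimit F u L) {P : B →ₗ[K] B}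
    (hP : ∀ n x, x ∈ F n → P x ∈ F n) : IsFilLimit F (fun n => P (u n)) (P L) := by
  intro n
  obtain ⟨N, hN⟩ := h n
  exact ⟨N, fun p hp => by simpa using hP n _ (hN p hp)⟩

theorem IsFilLimit.add {u v : ℕ → B} {L M : B} (hu : IsFilLimit F u L) (hv : IsFilLimit F v M) :
    IsFilLimit F (fun n => u n + v n) (L + M) := by
  intro n
  obtain ⟨N, hN⟩ := hu n
  obtain ⟨N', hN'⟩ := hv n
  refine ⟨max N N', fun p hp => ?_⟩
  have := (F n).add_mem (hN p (le_of_max_le_left hp)) (hN' p (le_of_max_le_right hp))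
  rwa [show u p + v p - (L + M) = u p - L + (v p - M) by abel]

theorem IsFilLimit.neg {u : ℕ → B} {L : B} (hu : IsFilLimit F u L) :
    IsFilLimit F (fun n => -u n) (-L) := by
  intro n
  obtain ⟨N, hN⟩ := hu n
  refine ⟨N, fun p hp => ?_⟩
  have := (F n).neg_mem (hN p hp)
  rwa [show -u p - -L = -(u p - L) by abel]

theorem IsFilLimit.sub {u v : ℕ → B} {L M : B} (hu : IsFilLimit F u L) (hv : IsFilLimit F v M) :
    IsFilLimit F (fun n => u n - v n) (L - M) := by
  simpa only [sub_eq_add_neg] using hu.add hv.neg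

theorem IsFilLimit.comp_succ {u : ℕ → B} {L : B} (hu : IsFilLimit F u L) :
    IsFilLimit F (fun n => u (n + 1)) L := by
  intro n
  obtain ⟨N, hN⟩ := hu n
  exact ⟨N, fun p hp => hN (p + 1) (by omega)⟩

theorem isFilLimit_const (x : B) : IsFilLimit F (fun _ => x) x :=
  fun n => ⟨0, fun _ _ => by rw [sub_self]; exact (F n).zero_mem⟩

theorem isFilLimit_of_sub_mem (hanti : Antitone F) {u : ℕ → B} {L : B}
    (h : ∀ n, u n - L ∈ F n) : IsFilLimit F u L :=
  fun n => ⟨n, fun p hp => hanti hp (h p)⟩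

namespace IsCompleteFiltered

variable (hF : IsCompleteFiltered F)
include hF

theorem antitone' : Antitone F := antitone_nat_of_succ_le hF.antitone

theorem mem_zero (x : B) : x ∈ F 0 := by rw [hF.zero_eq_top]; trivial

theorem mul_mem_left {n : ℕ} (x : B) {y : B} (hy : y ∈ F n) : x * y ∈ F n := by
  simpa using hF.mul_mem 0 n x y (hF.mem_zero x) hy

theorem mul_mem_right {n : ℕ} {x : B} (y : B) (hx : x ∈ F n) : x * y ∈ F n := by
  simpa using hF.mul_mem n 0 x y hx (hF.mem_zero y)

theorem mul_sub_one_mem {x y : B} (hx : x - 1 ∈ F 1) (hy : y - 1 ∈ F 1) : x * y - 1 ∈ F 1 := by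
  rw [show x * y - 1 = (x - 1) * y + (y - 1) by noncomm_ring]
  exact (F 1).add_mem (hF.mul_mem_right y hx) hy

theorem eq_of_sub_mem {x y : B} (h : ∀ n, x - y ∈ F n) : x = y :=
  sub_eq_zero.1 (hF.separated _ h)

theorem isFilLimit_unique {u : ℕ → B} {L M : B} (hL : IsFilLimit F u L)
    (hM : IsFilLimit F u M) : L = M := by
  refine hF.eq_of_sub_mem fun n => ?_
  obtain ⟨N, hN⟩ := hL n
  obtain ⟨N', hN'⟩ := hM n
  have h1 := hN _ (le_max_left N N')
  have h2 := hN' _ (le_max_right N N')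
  have := (F n).sub_mem h2 h1
  rwa [sub_sub_sub_cancel_left] at this

theorem filLim_eq {u : ℕ → B} {L : B} (hL : IsFilLimit F u L) : filLim F u = L := by
  have h : ∃ L, IsFilLimit F u L := ⟨L, hL⟩
  rw [filLim, dif_pos h]
  exact hF.isFilLimit_unique h.choose_spec hL

/-- Telescoping gives convergence with an explicit rate: the `n`-th term is already correct modulo
`F n`. Later inductions on the filtration degree rely on this rate. -/
theorem isFilLimit_filLim {u : ℕ → B} (h : ∀ n, u (n + 1) - u n ∈ F n) :
    ∀ n, u n - filLim F u ∈ F n := by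
  have key : ∀ n k, u (n + k) - u n ∈ F n := by
    intro n k
    induction k with
    | zero => simp
    | succ k ih =>
      rw [← sub_add_sub_cancel _ (u (n + k))]
      exact (F n).add_mem (hF.antitone' (Nat.le_add_right n k) (h (n + k))) ih
  obtain ⟨L, hL⟩ := hF.complete u fun n => ⟨n, fun p hp q hq => by
    obtain ⟨i, rfl⟩ := Nat.exists_eq_add_of_le hp
    obtain ⟨j, rfl⟩ := Nat.exists_eq_add_of_le hq
    rw [← sub_sub_sub_cancel_right _ _ (u n)]
    exact (F n).sub_mem (key n i) (key n j)⟩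
  intro n
  rw [hF.filLim_eq hL]
  obtain ⟨N, hN⟩ := hL n
  have h1 := hN (n + N) (by omega)
  have := (F n).sub_mem h1 (key n N)
  rwa [sub_sub_sub_cancel_left] at this

theorem pow_mem {x : B} (hx : x ∈ F 1) (n : ℕ) : x ^ n ∈ F n := by
  induction n with
  | zero => exact hF.mem_zero _
  | succ n ih => rw [pow_succ]; exact hF.mul_mem n 1 _ _ ih hx

theorem pow_sub_pow_mem {x y : B} (hx : x ∈ F 1) (hy : y ∈ F 1) {n : ℕ} (h : x - y ∈ F n)
    (k : ℕ) : x ^ (k + 1) - y ^ (k + 1) ∈ F (n + k) := by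
  induction k with
  | zero => simpa using h
  | succ k ih =>
    rw [pow_succ, pow_succ y, show x ^ (k + 1) * x - y ^ (k + 1) * y
      = (x ^ (k + 1) - y ^ (k + 1)) * x + y ^ (k + 1) * (x - y) by noncomm_ring]
    refine (F _).add_mem (hF.mul_mem (n + k) 1 _ _ ih hx) ?_
    rw [add_comm n (k + 1)]
    exact hF.mul_mem _ _ _ _ (hF.pow_mem hy _) h

theorem sum_sub_filEval_mem (p : PowerSeries K) {x : B} (hx : x ∈ F 1) (N : ℕ) :
    ∑ n ∈ Finset.range N, PowerSeries.coeff n p • x ^ n - filEval F p x ∈ F N := by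
  refine hF.isFilLimit_filLim (u := fun N => ∑ n ∈ Finset.range N, PowerSeries.coeff n p • x ^ n)
    (fun n => ?_) N
  rw [Finset.sum_range_succ, add_sub_cancel_left]
  exact (F n).smul_mem _ (hF.pow_mem hx n)

theorem isFilLimit_filEval (p : PowerSeries K) {x : B} (hx : x ∈ F 1) :
    IsFilLimit F (fun N => ∑ n ∈ Finset.range N, PowerSeries.coeff n p • x ^ n)
      (filEval F p x) :=
  isFilLimit_of_sub_mem hF.antitone' (hF.sum_sub_filEval_mem p hx)

theorem aeval_trunc_sub_filEval_mem (p : PowerSeries K) {x : B} (hx : x ∈ F 1) (N : ℕ) :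
    Polynomial.aeval x (PowerSeries.trunc N p) - filEval F p x ∈ F N := by
  rw [Polynomial.aeval_def, PowerSeries.eval₂_trunc_eq_sum_range]
  simpa only [Algebra.smul_def] using hF.sum_sub_filEval_mem p hx N

/-- Modulo `F N` the value of a series depends only on its coefficients below `N`, since `x ^ N ∈ F
N`. Identities between series thus reduce to identities between polynomials. -/
theorem aeval_sub_filEval_mem (p : PowerSeries K) (q : Polynomial K) {x : B} (hx : x ∈ F 1) (N : ℕ)
    (h : ∀ d < N, q.coeff d = PowerSeries.coeff d p) :
    Polynomial.aeval x q - filEval F p x ∈ F N := by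
  rw [← sub_add_sub_cancel _ (Polynomial.aeval x (PowerSeries.trunc N p))]
  refine (F N).add_mem ?_ (hF.aeval_trunc_sub_filEval_mem p hx N)
  have : Polynomial.X ^ N ∣ q - PowerSeries.trunc N p := by
    rw [Polynomial.X_pow_dvd_iff]
    intro d hd
    simp [PowerSeries.coeff_trunc, hd, h d hd]
  obtain ⟨r, hr⟩ := this
  rw [← map_sub, hr, map_mul, map_pow, Polynomial.aeval_X]
  exact hF.mul_mem_right _ (hF.pow_mem hx N)

theorem filEval_eq_of_aeval {p : PowerSeries K} {x y : B} (hx : x ∈ F 1) (q : ℕ → Polynomial K)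
    (hq : ∀ N, ∀ d < N, (q N).coeff d = PowerSeries.coeff d p)
    (h : ∀ N, Polynomial.aeval x (q N) - y ∈ F N) : filEval F p x = y := by
  refine hF.eq_of_sub_mem fun N => ?_
  have := (F N).sub_mem (h N) (hF.aeval_sub_filEval_mem p (q N) hx N (hq N))
  rwa [sub_sub_sub_cancel_left] at this

theorem filEval_coe (q : Polynomial K) {x : B} (hx : x ∈ F 1) :
    filEval F (q : PowerSeries K) x = Polynomial.aeval x q :=
  hF.filEval_eq_of_aeval hx (fun _ => q) (by simp) (by simp)

theorem filEval_add (p q : PowerSeries K) {x : B} (hx : x ∈ F 1) :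
    filEval F (p + q) x = filEval F p x + filEval F q x := by
  refine hF.filEval_eq_of_aeval hx (fun N => PowerSeries.trunc N p + PowerSeries.trunc N q)
    (fun N d hd => by simp [PowerSeries.coeff_trunc, hd]) fun N => ?_
  rw [map_add, add_sub_add_comm]
  exact (F N).add_mem (hF.aeval_trunc_sub_filEval_mem p hx N)
    (hF.aeval_trunc_sub_filEval_mem q hx N)

theorem filEval_mul (p q : PowerSeries K) {x : B} (hx : x ∈ F 1) :
    filEval F (p * q) x = filEval F p x * filEval F q x := by
  refine hF.filEval_eq_of_aeval hx (fun N => PowerSeries.trunc N p * PowerSeries.trunc N q)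
    (fun N d hd => ?_) fun N => ?_
  · rw [PowerSeries.coeff_mul_eq_coeff_trunc_mul_trunc p q hd, ← Polynomial.coe_mul,
      Polynomial.coeff_coe]
  · rw [map_mul]
    have h1 := hF.aeval_trunc_sub_filEval_mem p hx N
    have h2 := hF.aeval_trunc_sub_filEval_mem q hx N
    have := (F N).add_mem (hF.mul_mem_right (Polynomial.aeval x (PowerSeries.trunc N q)) h1)
      (hF.mul_mem_left (filEval F p x) h2)
    convert this using 1
    noncomm_ring

/-- Evaluation of power series at an element of positive filtration degree, as an algebra
morphism. -/
def filEvalHom {x : B} (hx : x ∈ F 1) : PowerSeries K →ₐ[K] B :=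
  AlgHom.ofLinearMap
    { toFun := fun p => filEval F p x
      map_add' := fun p q => hF.filEval_add p q hx
      map_smul' := fun c p => by
        rw [PowerSeries.smul_eq_C_mul, hF.filEval_mul _ _ hx, ← Polynomial.coe_C,
          hF.filEval_coe _ hx, Polynomial.aeval_C, Algebra.smul_def]
        rfl }
    (by
      change filEval F 1 x = 1
      rw [← Polynomial.coe_one, hF.filEval_coe _ hx, map_one])
    (fun p q => hF.filEval_mul p q hx)

theorem filEvalHom_apply {x : B} (hx : x ∈ F 1) (p : PowerSeries K) :
    hF.filEvalHom hx p = filEval F p x := rfl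

theorem filEval_mem_of_constantCoeff {p : PowerSeries K} (hp : PowerSeries.constantCoeff p = 0)
    {x : B} (hx : x ∈ F 1) : filEval F p x ∈ F 1 := by
  have := hF.sum_sub_filEval_mem p hx 1
  simpa [hp] using this

/-- Split `p` into its truncation at `N` and a multiple of `X ^ N`. Evaluation is an algebra
morphism, so it commutes with the polynomial part; the rest lies in `F N`, because `q` takes its
value in `F 1`. -/
theorem filEval_subst (p : PowerSeries K) {q : PowerSeries K}
    (hq : PowerSeries.constantCoeff q = 0) {x : B} (hx : x ∈ F 1) :
    filEval F (p.subst q) x = filEval F p (filEval F q x) := by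
  have hy := hF.filEval_mem_of_constantCoeff hq hx
  have hs : PowerSeries.HasSubst q := PowerSeries.HasSubst.of_constantCoeff_zero' hq
  refine hF.eq_of_sub_mem fun N => ?_
  rw [← sub_add_sub_cancel _ (Polynomial.aeval (filEval F q x) (PowerSeries.trunc N p))]
  refine (F N).add_mem ?_ (hF.aeval_trunc_sub_filEval_mem p hy N)
  have h1 : p.subst q = q ^ N * (PowerSeries.mk fun i => PowerSeries.coeff (i + N) p).subst q
      + Polynomial.aeval q (PowerSeries.trunc N p) := by
    conv_lhs => rw [PowerSeries.eq_X_pow_mul_shift_add_trunc N p]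
    rw [PowerSeries.subst_add hs, PowerSeries.subst_mul hs, PowerSeries.subst_pow hs,
      PowerSeries.subst_X hs, PowerSeries.subst_coe hs]
  rw [h1, hF.filEval_add _ _ hx, hF.filEval_mul _ _ hx, ← hF.filEvalHom_apply hx (q ^ N), map_pow,
    ← hF.filEvalHom_apply hx (Polynomial.aeval q _), ← Polynomial.aeval_algHom_apply,
    hF.filEvalHom_apply, add_sub_cancel_right]
  exact hF.mul_mem_right _ (hF.pow_mem hy N)

/-- A power series without linear term is contracting. -/
theorem filEval_sub_mem {p : PowerSeries K} (hp : PowerSeries.coeff 1 p = 0) {x y : B}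
    (hx : x ∈ F 1) (hy : y ∈ F 1) {n : ℕ} (h : x - y ∈ F n) :
    filEval F p x - filEval F p y ∈ F (n + 1) := by
  obtain ⟨N, hN⟩ := (hF.isFilLimit_filEval p hx).sub (hF.isFilLimit_filEval p hy) (n + 1)
  have h1 := hN N le_rfl
  rw [← sub_sub_self (∑ n ∈ Finset.range N, PowerSeries.coeff n p • x ^ n -
    ∑ n ∈ Finset.range N, PowerSeries.coeff n p • y ^ n) (filEval F p x - filEval F p y)]
  refine (F _).sub_mem ?_ h1
  rw [← Finset.sum_sub_distrib]
  refine (F _).sum_mem fun i _ => ?_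
  rw [← smul_sub]
  -- Constant terms cancel, the linear coefficient vanishes, and degree `i + 2` gains `i + 1 ≥ 1`
  -- filtration steps.
  match i with
  | 0 => simp
  | 1 => simp [hp]
  | i + 2 => exact (F _).smul_mem _ (hF.antitone' (by omega) (hF.pow_sub_pow_mem hx hy h (i + 1)))

end IsCompleteFiltered

end Filtered

/-! ### Exponential, logarithm and the BCH-recursion in complete filtered algebras -/

section ExpLog

variable {K B : Type*} [Field K] [CharZero K] [Ring B] [Algebra K B] {F : ℕ → Submodule K B}

theorem filExp_eq_filEval (x : B) : filExp F x = filEval F (PowerSeries.exp K) x := by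
  simp [filExp, filEval, PowerSeries.coeff_exp]

namespace IsCompleteFiltered

variable (hF : IsCompleteFiltered F)
include hF

theorem isFilLimit_filExp {x : B} (hx : x ∈ F 1) :
    IsFilLimit F (fun N => ∑ n ∈ Finset.range N, ((n.factorial : K)⁻¹) • x ^ n) (filExp F x) := by
  have := hF.isFilLimit_filEval (PowerSeries.exp K) hx
  rw [← filExp_eq_filEval] at this
  simpa [PowerSeries.coeff_exp] using this

theorem filLog_eq_filEval {y : B} (hy : y - 1 ∈ F 1) :
    filLog F y = filEval F (PowerSeries.log K) (y - 1) := by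
  refine hF.filLim_eq ?_
  -- The sums in `filLog` start with the linear term; as the constant coefficient of the series is
  -- zero, a shift by one matches the indices.
  convert (hF.isFilLimit_filEval (PowerSeries.log K) hy).comp_succ using 2 with N
  rw [Finset.sum_range_succ', PowerSeries.coeff_log, if_pos rfl, zero_smul, add_zero,
    ← Finset.sum_neg_distrib]
  refine Finset.sum_congr rfl fun n _ => ?_
  rw [PowerSeries.coeff_log, if_neg n.succ_ne_zero, neg_pow, ← smul_neg, ← neg_mul,
    ← neg_one_mul ((-1 : B) ^ (n + 1)), ← pow_succ']
  have : ((-1 : B) ^ (n + 1 + 1)) = ((-1 : K) ^ (n + 1 + 1)) • (1 : B) := by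
    rw [← Algebra.algebraMap_eq_smul_one]; simp
  rw [this, smul_mul_assoc, one_mul, smul_smul]
  congr 1
  simp [div_eq_mul_inv, mul_comm]

theorem filExp_sub_one_mem {x : B} (hx : x ∈ F 1) : filExp F x - 1 ∈ F 1 := by
  have := hF.sum_sub_filEval_mem (PowerSeries.exp K) hx 1
  rw [← filExp_eq_filEval] at this
  rw [← neg_sub, Submodule.neg_mem_iff]
  simpa using this

theorem filLog_mem {y : B} (hy : y - 1 ∈ F 1) : filLog F y ∈ F 1 := by
  rw [hF.filLog_eq_filEval hy]
  exact hF.filEval_mem_of_constantCoeff PowerSeries.constantCoeff_log hy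

theorem filExp_filLog {y : B} (hy : y - 1 ∈ F 1) : filExp F (filLog F y) = y := by
  rw [filExp_eq_filEval, hF.filLog_eq_filEval hy,
    ← hF.filEval_subst _ PowerSeries.constantCoeff_log hy, exp_subst_log, hF.filEval_add _ _ hy,
    ← Polynomial.coe_X, ← Polynomial.coe_one, hF.filEval_coe _ hy, hF.filEval_coe _ hy]
  simp

/-- The higher order part of the exponential is contracting. -/
theorem filExp_sub_sub_mem {x y : B} (hx : x ∈ F 1) (hy : y ∈ F 1) {n : ℕ} (h : x - y ∈ F n) :
    (filExp F x - x) - (filExp F y - y) ∈ F (n + 1) := by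
  have key : ∀ z ∈ F 1, filExp F z - z = filEval F (PowerSeries.exp K - PowerSeries.X) z := by
    intro z hz
    rw [filExp_eq_filEval, ← hF.filEvalHom_apply hz, ← hF.filEvalHom_apply hz, map_sub,
      hF.filEvalHom_apply, hF.filEvalHom_apply, ← Polynomial.coe_X, hF.filEval_coe _ hz,
      Polynomial.aeval_X]
  rw [key x hx, key y hy]
  exact hF.filEval_sub_mem (by simp [PowerSeries.coeff_exp]) hx hy h

/-- The higher order part of the logarithm is contracting. -/
theorem filLog_sub_sub_mem {x y : B} (hx : x - 1 ∈ F 1) (hy : y - 1 ∈ F 1) {n : ℕ}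
    (h : x - y ∈ F n) : (filLog F x - x) - (filLog F y - y) ∈ F (n + 1) := by
  have key : ∀ z, z - 1 ∈ F 1 →
      filLog F z - z = filEval F (PowerSeries.log K - PowerSeries.X) (z - 1) - 1 := by
    intro z hz
    rw [hF.filLog_eq_filEval hz, ← hF.filEvalHom_apply hz, ← hF.filEvalHom_apply hz, map_sub,
      hF.filEvalHom_apply, hF.filEvalHom_apply, ← Polynomial.coe_X, hF.filEval_coe _ hz,
      Polynomial.aeval_X]
    abel
  rw [key x hx, key y hy, sub_sub_sub_cancel_right]
  exact hF.filEval_sub_mem (by simp) hx hy (by simpa using h)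

theorem filExp_sub_mem {x y : B} (hx : x ∈ F 1) (hy : y ∈ F 1) {n : ℕ} (h : x - y ∈ F n) :
    filExp F x - filExp F y ∈ F n := by
  have := (F n).add_mem (hF.antitone n (hF.filExp_sub_sub_mem hx hy h)) h
  convert this using 1
  abel

/-- If the exponentials agree, the difference of the higher-order parts is `y - x`. By contraction,
`x - y ∈ F n` improves to `F (n + 1)`, and separatedness finishes. -/
theorem filExp_injOn {x y : B} (hx : x ∈ F 1) (hy : y ∈ F 1) (h : filExp F x = filExp F y) :
    x = y := by
  refine hF.eq_of_sub_mem fun n => ?_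
  induction n with
  | zero => exact hF.mem_zero _
  | succ n ih =>
    have := hF.filExp_sub_sub_mem hx hy ih
    rw [h, sub_sub_sub_cancel_left] at this
    rw [← neg_sub]
    exact (F _).neg_mem this

theorem filExp_mul_filExp_neg {x : B} (hx : x ∈ F 1) : filExp F x * filExp F (-x) = 1 := by
  rw [filExp_eq_filEval, filExp_eq_filEval, ← neg_one_smul K x, filEval_smul,
    ← hF.filEval_mul _ _ hx]
  have := PowerSeries.exp_mul_exp_neg_eq_one (A := K)
  rw [PowerSeries.evalNegHom] at this
  rw [this, ← Polynomial.coe_one, hF.filEval_coe _ hx, map_one]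

theorem filExp_neg_mul_filExp {x : B} (hx : x ∈ F 1) : filExp F (-x) * filExp F x = 1 := by
  simpa using hF.filExp_mul_filExp_neg ((F 1).neg_mem hx)

theorem filExp_natCast_smul {x : B} (hx : x ∈ F 1) (n : ℕ) :
    filExp F ((n : K) • x) = filExp F x ^ n := by
  rw [filExp_eq_filEval, filExp_eq_filEval, filEval_smul, ← PowerSeries.exp_pow_eq_rescale_exp,
    ← hF.filEvalHom_apply hx, ← hF.filEvalHom_apply hx, map_pow]

theorem isUnit_filExp {x : B} (hx : x ∈ F 1) : IsUnit (filExp F x) :=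
  ⟨⟨_, _, hF.filExp_mul_filExp_neg hx, hF.filExp_neg_mul_filExp hx⟩, rfl⟩

theorem inverse_filExp {x : B} (hx : x ∈ F 1) :
    Ring.inverse (filExp F x) = filExp F (-x) :=
  Ring.inverse_unit ⟨_, _, hF.filExp_mul_filExp_neg hx, hF.filExp_neg_mul_filExp hx⟩

theorem isUnit_of_sub_one_mem {y : B} (hy : y - 1 ∈ F 1) : IsUnit y := by
  rw [← hF.filExp_filLog hy]
  exact hF.isUnit_filExp (hF.filLog_mem hy)

theorem filBCH_mem {x y : B} (hx : x ∈ F 1) (hy : y ∈ F 1) : filBCH F x y ∈ F 1 :=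
  (F 1).sub_mem ((F 1).sub_mem (hF.filLog_mem (hF.mul_sub_one_mem (hF.filExp_sub_one_mem hx)
    (hF.filExp_sub_one_mem hy))) hx) hy

theorem filExp_add_filBCH {x y : B} (hx : x ∈ F 1) (hy : y ∈ F 1) :
    filExp F (x + y + filBCH F x y) = filExp F x * filExp F y := by
  rw [filBCH, show ∀ l : B, x + y + (l - x - y) = l by intro l; abel]
  exact hF.filExp_filLog (hF.mul_sub_one_mem (hF.filExp_sub_one_mem hx) (hF.filExp_sub_one_mem hy))

/-- `BCH` is contracting. -/
theorem filBCH_sub_mem {x x' y y' : B} (hx : x ∈ F 1) (hx' : x' ∈ F 1) (hy : y ∈ F 1)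
    (hy' : y' ∈ F 1) {n : ℕ} (h : x - x' ∈ F n) (h' : y - y' ∈ F n) :
    filBCH F x y - filBCH F x' y' ∈ F (n + 1) := by
  have e := hF.filExp_sub_one_mem hx
  have e' := hF.filExp_sub_one_mem hx'
  have f := hF.filExp_sub_one_mem hy
  have f' := hF.filExp_sub_one_mem hy'
  have h1 := hF.filExp_sub_sub_mem hx hx' h
  have h2 := hF.filExp_sub_sub_mem hy hy' h'
  have d1 := hF.filExp_sub_mem hx hx' h
  have d2 := hF.filExp_sub_mem hy hy' h'
  have h3 := hF.mul_mem n 1 _ _ d1 f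
  have h4 := hF.mul_mem 1 n _ _ e' d2
  rw [add_comm] at h4
  have d3 : filExp F x * filExp F y - filExp F x' * filExp F y' ∈ F n := by
    have := (F n).add_mem (hF.mul_mem_right (filExp F y) d1) (hF.mul_mem_left (filExp F x') d2)
    convert this using 1
    noncomm_ring
  have h5 := hF.filLog_sub_sub_mem (hF.mul_sub_one_mem e f) (hF.mul_sub_one_mem e' f') d3
  -- With `u = exp x * exp y`, BCH is the sum of `log u - u`, `exp x - x`, `exp y - y` and `(exp x -
  -- 1) * (exp y - 1) - 1`. Each of these gains one degree on differences.
  have := (F _).add_mem h5 ((F _).add_mem ((F _).add_mem h1 h2) ((F _).add_mem h3 h4))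
  unfold filBCH
  convert this using 1
  noncomm_ring

section Chi

variable {P : B →ₗ[K] B} (hP : ∀ n x, x ∈ F n → P x ∈ F n)
include hP

theorem chiApprox_mem {b : B} (hb : b ∈ F 1) (n : ℕ) : chiApprox F P b n ∈ F 1 := by
  induction n with
  | zero => exact hb
  | succ n ih =>
    exact (F 1).sub_mem hb (hF.filBCH_mem (hP 1 _ ih) ((F 1).sub_mem ih (hP 1 _ ih)))

/-- One step of the recursion gains one filtration degree, which yields both convergence and the
fixed-point equation. Only filtration preservation of `P` matters here. -/
theorem filBCH_map_sub_mem {x y : B} (hx : x ∈ F 1) (hy : y ∈ F 1) {n : ℕ} (h : x - y ∈ F n) :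
    filBCH F (P x) (x - P x) - filBCH F (P y) (y - P y) ∈ F (n + 1) := by
  have h1 : P x - P y ∈ F n := by simpa using hP n _ h
  refine hF.filBCH_sub_mem (hP 1 _ hx) (hP 1 _ hy) ((F 1).sub_mem hx (hP 1 _ hx))
    ((F 1).sub_mem hy (hP 1 _ hy)) h1 ?_
  rw [sub_sub_sub_comm]
  exact (F n).sub_mem h h1

theorem chiApprox_sub_chi_mem {b : B} (hb : b ∈ F 1) (n : ℕ) :
    chiApprox F P b n - chi F P b ∈ F n := by
  refine hF.isFilLimit_filLim (fun n => ?_) n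
  induction n with
  | zero => exact hF.mem_zero _
  | succ n ih =>
    have := hF.filBCH_map_sub_mem hP (hF.chiApprox_mem hP hb (n + 1)) (hF.chiApprox_mem hP hb n) ih
    rw [chiApprox.eq_def F P b (n + 1 + 1), chiApprox.eq_def F P b (n + 1)]
    dsimp only
    rw [sub_sub_sub_cancel_left, ← neg_sub]
    exact (F _).neg_mem this

theorem isFilLimit_chi {b : B} (hb : b ∈ F 1) : IsFilLimit F (chiApprox F P b) (chi F P b) :=
  isFilLimit_of_sub_mem hF.antitone' (hF.chiApprox_sub_chi_mem hP hb)

theorem chi_mem {b : B} (hb : b ∈ F 1) : chi F P b ∈ F 1 := by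
  rw [← sub_sub_self (chiApprox F P b 1) (chi F P b)]
  exact (F 1).sub_mem (hF.chiApprox_mem hP hb 1) (hF.chiApprox_sub_chi_mem hP hb 1)

theorem chi_eq {b : B} (hb : b ∈ F 1) :
    chi F P b = b - filBCH F (P (chi F P b)) (chi F P b - P (chi F P b)) := by
  refine hF.eq_of_sub_mem fun n => ?_
  have h1 := hF.antitone _ (hF.chiApprox_sub_chi_mem hP hb (n + 1))
  have h2 := hF.antitone _ (hF.filBCH_map_sub_mem hP (hF.chiApprox_mem hP hb n) (hF.chi_mem hP hb)
    (hF.chiApprox_sub_chi_mem hP hb n))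
  have := (F n).neg_mem ((F n).add_mem h1 h2)
  rw [chiApprox] at this
  convert this using 1
  abel

/-- The fixed-point equation reads `b = P c + (c - P c) + BCH(P c, c - P c)` with `c = χ(b)`;
exponentiate. -/
theorem filExp_eq_mul_filExp_chi {b : B} (hb : b ∈ F 1) :
    filExp F b = filExp F (P (chi F P b)) * filExp F (chi F P b - P (chi F P b)) := by
  have hc := hF.chi_mem hP hb
  rw [← hF.filExp_add_filBCH (hP 1 _ hc) ((F 1).sub_mem hc (hP 1 _ hc))]
  congr 1
  nth_rewrite 1 [eq_sub_iff_add_eq.1 (hF.chi_eq hP hb) |>.symm]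
  abel

end Chi

end IsCompleteFiltered

end ExpLog

/-! ### Atkinson's factorization and Spitzer's identity -/

section RotaBaxter

variable {K B : Type*} [Field K] [Ring B] [Algebra K B] {F : ℕ → Submodule K B} {R : B →ₗ[K] B}

theorem IsRotaBaxter.mul_eq_map_doubleMul (hR : IsRotaBaxter (1 : K) R) (x y : B) :
    R x * R y = R (doubleMul R x y) := by
  rw [hR x y, one_smul, doubleMul]

theorem doubleMul_eq (x y : B) :
    doubleMul R x y = R x * R y - (x - R x) * (y - R y) := by
  unfold doubleMul
  noncomm_ring

theorem IsRotaBaxter.map_doublePow (hR : IsRotaBaxter (1 : K) R) (x : B) (n : ℕ) :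
    R (doublePow R x n) = R x ^ (n + 1) := by
  induction n with
  | zero => simp [doublePow]
  | succ n ih => rw [doublePow, ← hR.mul_eq_map_doubleMul, ih, ← pow_succ]

/-- Both `R` and `-(id - R)` turn double products into products, and their difference is the
identity. -/
theorem IsRotaBaxter.doublePow_eq (hR : IsRotaBaxter (1 : K) R) (x : B) (n : ℕ) :
    doublePow R x n = R x ^ (n + 1) - (-(x - R x)) ^ (n + 1) := by
  induction n with
  | zero => simp [doublePow]
  | succ n ih =>
    rw [doublePow, doubleMul_eq, hR.map_doublePow, ih, pow_succ _ (n + 1),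
      pow_succ (-(x - R x)) (n + 1)]
    noncomm_ring

namespace IsCompleteFilteredRotaBaxter

variable (h : IsCompleteFilteredRotaBaxter (1 : K) F R)
include h

theorem sub_map_mem {n : ℕ} {x : B} (hx : x ∈ F n) : x - R x ∈ F n :=
  (F n).sub_mem hx (h.map_mem n x hx)

theorem isFilLimit_doublePow [CharZero K] {x : B} (hx : x ∈ F 1) :
    IsFilLimit F (fun N => ∑ n ∈ Finset.range N, (((n + 1).factorial : K)⁻¹) • doublePow R x n)
      (filExp F (R x) - filExp F (-(x - R x))) := by
  have hF := h.completeFiltered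
  convert ((hF.isFilLimit_filExp (h.map_mem 1 x hx)).sub
    (hF.isFilLimit_filExp ((F 1).neg_mem (h.sub_map_mem hx)))).comp_succ using 2 with N
  rw [Finset.sum_range_succ',
    Finset.sum_range_succ' (fun n => (n.factorial : K)⁻¹ • (-(x - R x)) ^ n)]
  simp only [pow_zero, add_sub_add_right_eq_sub, ← Finset.sum_sub_distrib, ← smul_sub,
    h.rotaBaxter.doublePow_eq]

theorem doubleExp_eq [CharZero K] {x : B} (hx : x ∈ F 1) :
    doubleExp F R x = 1 + (filExp F (R x) - filExp F (-(x - R x))) := by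
  rw [doubleExp, h.completeFiltered.filLim_eq (h.isFilLimit_doublePow hx)]

/-- Spitzer's identity. -/
theorem map_filExp_sub_filExp [CharZero K] {x : B} (hx : x ∈ F 1) :
    R (filExp F (R x) - filExp F (-(x - R x))) = filExp F (R x) - 1 := by
  have hF := h.completeFiltered
  -- Applying `R` termwise to the double exponential series leaves the ordinary exponential series
  -- of `R x` without its constant term.
  refine hF.isFilLimit_unique ((h.isFilLimit_doublePow hx).map h.map_mem) ?_
  convert ((hF.isFilLimit_filExp (h.map_mem 1 x hx)).comp_succ).sub (isFilLimit_const 1)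
    using 2 with N
  rw [Finset.sum_range_succ', map_sum]
  simp [h.rotaBaxter.map_doublePow]

theorem sub_map_filExp_sub_filExp [CharZero K] {x : B} (hx : x ∈ F 1) :
    (filExp F (R x) - filExp F (-(x - R x))) - R (filExp F (R x) - filExp F (-(x - R x)))
      = 1 - filExp F (-(x - R x)) := by
  rw [h.map_filExp_sub_filExp hx]
  abel

end IsCompleteFilteredRotaBaxter

namespace IsCompleteFiltered

variable (hF : IsCompleteFiltered F) (hP : ∀ n x, x ∈ F n → R x ∈ F n)
include hF hP

/-- The right-hand side is a contraction in `X`, because `a ∈ F 1` raises the degree; the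
Rota–Baxter relation plays no role. -/
theorem eq_of_eq_one_sub_map_mul_right {a X Y : B} (ha : a ∈ F 1) (hX : X = 1 - R (X * a))
    (hY : Y = 1 - R (Y * a)) : X = Y := by
  refine hF.eq_of_sub_mem fun n => ?_
  induction n with
  | zero => exact hF.mem_zero _
  | succ n ih =>
    rw [hX, hY, sub_sub_sub_cancel_left, ← map_sub, ← sub_mul, ← neg_sub X Y, neg_mul, map_neg]
    exact (F _).neg_mem (hP _ _ (hF.mul_mem n 1 _ _ ih ha))

theorem eq_of_eq_one_sub_map_mul_left {a X Y : B} (ha : a ∈ F 1) (hX : X = 1 - R (a * X))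
    (hY : Y = 1 - R (a * Y)) : X = Y := by
  refine hF.eq_of_sub_mem fun n => ?_
  induction n with
  | zero => exact hF.mem_zero _
  | succ n ih =>
    rw [hX, hY, sub_sub_sub_cancel_left, ← map_sub, ← mul_sub, ← neg_sub X Y, mul_neg, map_neg,
      add_comm]
    exact (F _).neg_mem (hP _ _ (hF.mul_mem 1 n _ _ ha ih))

/-- The partial sums are the Picard iterates `S_{N+1} = 1 - R (S_N * a)` started at `0`, so each
step brings them one degree closer to the given solution. -/
theorem isFilLimit_leftIter {a X : B} (ha : a ∈ F 1) (hX : X = 1 - R (X * a)) :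
    IsFilLimit F (fun N => ∑ n ∈ Finset.range N, (-1) ^ n * leftIter R a n) X := by
  refine isFilLimit_of_sub_mem hF.antitone' fun N => ?_
  induction N with
  | zero => exact hF.mem_zero _
  | succ N ih =>
    have e : ∑ n ∈ Finset.range (N + 1), (-1) ^ n * leftIter R a n
        = 1 - R ((∑ n ∈ Finset.range N, (-1) ^ n * leftIter R a n) * a) := by
      rw [Finset.sum_range_succ', Finset.sum_mul, map_sum, add_comm, sub_eq_add_neg,
        ← Finset.sum_neg_distrib]
      congr 1
      · simp [leftIter]
      · refine Finset.sum_congr rfl fun n _ => ?_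
        rcases neg_one_pow_eq_or B n with hn | hn <;> simp [pow_succ, hn, leftIter]
    rw [e, hX, sub_sub_sub_cancel_left, ← map_sub, ← sub_mul, ← neg_sub, neg_mul, map_neg]
    exact (F _).neg_mem (hP _ _ (hF.mul_mem N 1 _ _ ih ha))

theorem isFilLimit_rightIter {a X : B} (ha : a ∈ F 1) (hX : X = 1 - R (a * X)) :
    IsFilLimit F (fun N => ∑ n ∈ Finset.range N, (-1) ^ n * rightIter R a n) X := by
  refine isFilLimit_of_sub_mem hF.antitone' fun N => ?_
  induction N with
  | zero => exact hF.mem_zero _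
  | succ N ih =>
    have e : ∑ n ∈ Finset.range (N + 1), (-1) ^ n * rightIter R a n
        = 1 - R (a * ∑ n ∈ Finset.range N, (-1) ^ n * rightIter R a n) := by
      rw [Finset.sum_range_succ', Finset.mul_sum, map_sum, add_comm, sub_eq_add_neg,
        ← Finset.sum_neg_distrib]
      congr 1
      · simp [rightIter]
      · refine Finset.sum_congr rfl fun n _ => ?_
        rcases neg_one_pow_eq_or B n with hn | hn <;> simp [pow_succ, hn, rightIter]
    rw [e, hX, sub_sub_sub_cancel_left, ← map_sub, ← mul_sub, ← neg_sub, mul_neg, map_neg,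
      add_comm]
    exact (F _).neg_mem (hP _ _ (hF.mul_mem 1 N _ _ ha ih))

end IsCompleteFiltered

end RotaBaxter

/-! ### The convolution algebra of a connected graded bialgebra -/

section Convolution

variable {K H A : Type*} [Field K] [CommRing H] [Bialgebra K H] [CommRing A] [Algebra K A]

theorem ConvHom.add_apply (f g : ConvHom K H A) (x : H) : (f + g) x = f x + g x := rfl

theorem ConvHom.sub_apply (f g : ConvHom K H A) (x : H) : (f - g) x = f x - g x := rfl

theorem ConvHom.neg_apply (f : ConvHom K H A) (x : H) : (-f) x = -f x := rfl

theorem ConvHom.smul_apply (c : K) (f : ConvHom K H A) (x : H) : (c • f) x = c • f x := rfl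

theorem ConvHom.sum_apply {ι : Type*} (s : Finset ι) (f : ι → ConvHom K H A) (x : H) :
    (∑ i ∈ s, f i) x = ∑ i ∈ s, f i x := by
  rw [WithConv.ofConv_sum, LinearMap.sum_apply]

theorem postComp_apply (R : A →ₗ[K] A) (f : ConvHom K H A) (x : H) :
    postComp H R f x = R (f x) := rfl

theorem isRotaBaxter_postComp {θ : K} {R : A →ₗ[K] A} (hR : IsRotaBaxter θ R) :
    IsRotaBaxter θ (postComp H R) := by
  intro f g
  ext x
  have 𝓡 := Coalgebra.Repr.arbitrary K x
  simp only [postComp_apply, ConvHom.add_apply, ConvHom.sub_apply, ConvHom.smul_apply,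
    𝓡.convMul_apply, Finset.smul_sum, ← Finset.sum_add_distrib, ← Finset.sum_sub_distrib, map_sum]
  exact Finset.sum_congr rfl fun i _ => hR _ _

/-- Removing `x ⊗ 1` and `1 ⊗ x` from the coproduct subtracts `ψ x` and `φ x`; the leading `φ x`
restores the latter, leaving `ψ * φ - ψ` on all of `H`. -/
theorem barMap_eq (ψ φ : ConvHom K H A) (hψ : ψ 1 = 1) (hφ : φ 1 = 1) :
    barMap ψ φ = ψ * (φ - 1) := by
  ext x
  rw [mul_sub, mul_one, ConvHom.sub_apply]
  change φ x + LinearMap.mul' K A (TensorProduct.map ψ.ofConv φ.ofConv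
    (Coalgebra.comul x - x ⊗ₜ[K] 1 - 1 ⊗ₜ[K] x)) = _
  rw [map_sub, map_sub, map_sub, map_sub, LinearMap.convMul_apply]
  simp only [TensorProduct.map_tmul, LinearMap.mul'_apply, hψ, hφ]
  ring

theorem barMap_apply_of_comul_eq (ψ φ : ConvHom K H A) {ι : Type*} (s : Finset ι) (γ ρ : ι → H)
    (x : H) (h : (Coalgebra.comul x : H ⊗[K] H) = x ⊗ₜ[K] 1 + 1 ⊗ₜ[K] x
      + ∑ i ∈ s, γ i ⊗ₜ[K] ρ i) :
    barMap ψ φ x = φ x + ∑ i ∈ s, ψ (γ i) * φ (ρ i) := by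
  change φ x + LinearMap.mul' K A (TensorProduct.map ψ.ofConv φ.ofConv
    (Coalgebra.comul x - x ⊗ₜ[K] 1 - 1 ⊗ₜ[K] x)) = _
  rw [h, show x ⊗ₜ[K] (1 : H) + 1 ⊗ₜ[K] x + ∑ i ∈ s, γ i ⊗ₜ[K] ρ i - x ⊗ₜ[K] 1 - 1 ⊗ₜ[K] x
    = ∑ i ∈ s, γ i ⊗ₜ[K] ρ i by abel]
  simp

variable (G : ℕ → Submodule K H)

theorem postComp_mem_homFil (R : A →ₗ[K] A) (n : ℕ) (f : ConvHom K H A) (hf : f ∈ homFil A G n) :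
    postComp H R f ∈ homFil A G n := by
  intro k hk x hx
  rw [postComp_apply, hf k hk x hx, map_zero]

variable {G} [GradedAlgebra G]

theorem homFil_mul_mem (hG : IsConnectedGradedBialgebra G) (m n : ℕ) (f g : ConvHom K H A)
    (hf : f ∈ homFil A G m) (hg : g ∈ homFil A G n) : f * g ∈ homFil A G (m + n) := by
  intro k hk x hx
  have hle : (⨆ pq ∈ Finset.HasAntidiagonal.antidiagonal k,
      LinearMap.range (TensorProduct.mapIncl (G pq.1) (G pq.2))) ≤
      LinearMap.ker (LinearMap.mul' K A ∘ₗ TensorProduct.map f.ofConv g.ofConv) := by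
    refine iSup₂_le fun pq hpq => ?_
    rw [Finset.HasAntidiagonal.mem_antidiagonal] at hpq
    rw [LinearMap.range_le_ker_iff]
    ext y z
    have : f y.1 * g z.1 = 0 := by
      -- Since the two degrees sum to less than `m + n`, one of the factors must vanish.
      rcases lt_or_ge pq.1 m with h | h
      · rw [hf _ h _ y.2, zero_mul]
      · rw [hg pq.2 (by omega) _ z.2, mul_zero]
    simpa [TensorProduct.mapIncl] using this
  exact hle (hG.comul_mem k x hx)

variable (A) in
-- An element has only finitely many homogeneous components. Consequently a convergent sequence of
-- maps is eventually constant at each point.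
theorem exists_forall_homFil_apply_eq_zero (x : H) :
    ∃ N, ∀ n ≥ N, ∀ f ∈ homFil A G n, f x = 0 := by
  induction x using DirectSum.Decomposition.inductionOn G with
  | zero => exact ⟨0, fun n _ f _ => map_zero f.ofConv⟩
  | @homogeneous i m => exact ⟨i + 1, fun n hn f hf => hf i (by omega) m m.2⟩
  | add x y hx hy =>
    obtain ⟨M, hM⟩ := hx
    obtain ⟨N, hN⟩ := hy
    refine ⟨max M N, fun n hn f hf => ?_⟩
    rw [map_add, hM n (le_of_max_le_left hn) f hf, hN n (le_of_max_le_right hn) f hf, add_zero]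

theorem homFil_complete (u : ℕ → ConvHom K H A)
    (hu : ∀ n, ∃ N, ∀ p ≥ N, ∀ q ≥ N, u p - u q ∈ homFil A G n) :
    ∃ L, ∀ n, ∃ N, ∀ p ≥ N, u p - L ∈ homFil A G n := by
  choose N hN using hu
  -- On degree `k` the limit is read off at the index for `homFil A G (k + 1)`, the first step of
  -- the filtration that controls degree `k`.
  let L : H →ₗ[K] A := DirectSum.toModule K ℕ A
    (fun k => (u (N (k + 1))).ofConv ∘ₗ (G k).subtype) ∘ₗ
      (DirectSum.decomposeLinearEquiv G).toLinearMap
  have hL : ∀ k, ∀ x ∈ G k, L x = u (N (k + 1)) x := by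
    intro k x hx
    change DirectSum.toModule K ℕ A _ (DirectSum.decompose G x) = _
    rw [DirectSum.decompose_of_mem G hx, ← DirectSum.lof_eq_of K, DirectSum.toModule_lof]
    rfl
  refine ⟨WithConv.toConv L, fun n => ⟨(Finset.range (n + 1)).sup N, fun p hp k hk x hx => ?_⟩⟩
  have hpk : N (k + 1) ≤ p := (Finset.le_sup (Finset.mem_range.2 (by omega))).trans hp
  have := hN (k + 1) p hpk (N (k + 1)) le_rfl k k.lt_succ_self x hx
  rw [ConvHom.sub_apply] at this ⊢
  rw [WithConv.ofConv_toConv, hL k x hx, this]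

variable (A) in
theorem isCompleteFiltered_homFil (hG : IsConnectedGradedBialgebra G) :
    IsCompleteFiltered (homFil A G) where
  zero_eq_top := by
    ext f
    exact ⟨fun _ => trivial, fun _ k hk => absurd hk k.not_lt_zero⟩
  antitone n f hf k hk := hf k (by omega)
  mul_mem := homFil_mul_mem hG
  separated f hf := by
    ext x
    obtain ⟨N, hN⟩ := exists_forall_homFil_apply_eq_zero A (G := G) x
    exact hN N le_rfl f (hf N)
  complete := homFil_complete

/-- This is where connectedness enters: degree zero consists of the scalars, so a map is tested
there by its value at `1`. -/
theorem mem_homFil_one_iff (hG : IsConnectedGradedBialgebra G) (f : ConvHom K H A) :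
    f ∈ homFil A G 1 ↔ f 1 = 0 := by
  constructor
  · intro hf
    exact hf 0 one_pos 1 SetLike.GradedOne.one_mem
  · intro hf k hk x hx
    obtain rfl : k = 0 := by omega
    rw [hG.connected, Submodule.mem_one] at hx
    obtain ⟨c, rfl⟩ := hx
    rw [Algebra.algebraMap_eq_smul_one, map_smul, hf, smul_zero]

theorem sub_one_mem_homFil_iff (hG : IsConnectedGradedBialgebra G) (f : ConvHom K H A) :
    f - 1 ∈ homFil A G 1 ↔ f 1 = 1 := by
  rw [mem_homFil_one_iff hG, ConvHom.sub_apply, sub_eq_zero]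
  simp

theorem IsFilLimit.exists_apply_eq {u : ℕ → ConvHom K H A} {L : ConvHom K H A}
    (h : IsFilLimit (homFil A G) u L) (x : H) : ∃ N, ∀ p ≥ N, u p x = L x := by
  obtain ⟨M, hM⟩ := exists_forall_homFil_apply_eq_zero A (G := G) x
  obtain ⟨N, hN⟩ := h M
  exact ⟨N, fun p hp => sub_eq_zero.1 (hM M le_rfl _ (hN p hp))⟩

end Convolution

/-! ### Characters and infinitesimal characters -/

section Characters

variable {K H A : Type*} [Field K] [CommRing H] [Bialgebra K H] [CommRing A] [Algebra K A]

/-- The linear map `x ⊗ y ↦ f x * g y`. -/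
def tensorHom (f g : ConvHom K H A) : WithConv (H ⊗[K] H →ₗ[K] A) :=
  WithConv.toConv (LinearMap.mul' K A ∘ₗ TensorProduct.map f.ofConv g.ofConv)

theorem tensorHom_tmul (f g : ConvHom K H A) (x y : H) :
    tensorHom f g (x ⊗ₜ[K] y) = f x * g y := by
  simp [tensorHom]

/-- Commutativity of `A` makes its multiplication an algebra morphism `A ⊗ A → A`, and composing
with such a morphism respects convolution. -/
theorem tensorHom_mul (f g f' g' : ConvHom K H A) :
    tensorHom f g * tensorHom f' g' = tensorHom (f * f') (g * g') := by
  have h := LinearMap.algHom_comp_convMul_distrib (R := K) (Algebra.TensorProduct.lmul' K (S := A))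
    (WithConv.toConv (TensorProduct.map f.ofConv g.ofConv))
    (WithConv.toConv (TensorProduct.map f'.ofConv g'.ofConv))
  rw [TensorProduct.map_convMul_map] at h
  exact WithConv.ofConv_injective h.symm

theorem tensorHom_one_one : tensorHom (1 : ConvHom K H A) 1 = 1 := by
  ext x y
  simp [tensorHom, mul_comm]

theorem tensorHom_pow (f g : ConvHom K H A) (n : ℕ) :
    tensorHom f g ^ n = tensorHom (f ^ n) (g ^ n) := by
  induction n with
  | zero => simp [tensorHom_one_one]
  | succ n ih => rw [pow_succ, ih, tensorHom_mul, ← pow_succ, ← pow_succ]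

variable (K H A) in
/-- The pullback of linear maps along the multiplication of `H`, a morphism of convolution
algebras. -/
def mulPullback : ConvHom K H A →+* WithConv (H ⊗[K] H →ₗ[K] A) where
  toFun f := WithConv.toConv (f.ofConv ∘ₗ LinearMap.mul' K H)
  map_one' := by
    ext x y
    simp [mul_comm]
  map_mul' f g := WithConv.ofConv_injective
    (LinearMap.convMul_comp_coalgHom_distrib f g (Bialgebra.mulCoalgHom K H))
  map_zero' := rfl
  map_add' _ _ := rfl

theorem mulPullback_tmul (f : ConvHom K H A) (x y : H) :
    mulPullback K H A f (x ⊗ₜ[K] y) = f (x * y) := rfl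

/-- Characters become the group-like elements, and infinitesimal characters below the primitive
ones, for the pullback along multiplication. Closure properties are then computations in the
convolution algebra on `H ⊗ H`. -/
theorem isCharacter_iff (f : ConvHom K H A) :
    IsCharacter f ↔ f 1 = 1 ∧ mulPullback K H A f = tensorHom f f := by
  refine and_congr_right fun _ => ⟨fun h => ?_, fun h x y => ?_⟩
  · ext x y
    simpa [mulPullback_tmul, tensorHom_tmul] using h x y
  · rw [← mulPullback_tmul, h, tensorHom_tmul]

theorem isInfinitesimalCharacter_iff (f : ConvHom K H A) :
    IsInfinitesimalCharacter f ↔ mulPullback K H A f = tensorHom 1 f + tensorHom f 1 := by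
  refine ⟨fun h => ?_, fun h x y => ?_⟩
  · ext x y
    simpa [mulPullback_tmul, tensorHom_tmul] using h x y
  · rw [← mulPullback_tmul, h, WithConv.ofConv_add, LinearMap.add_apply, tensorHom_tmul,
      tensorHom_tmul, LinearMap.convOne_apply, LinearMap.convOne_apply]

theorem convMul_apply_one (f g : ConvHom K H A) : (f * g) 1 = f 1 * g 1 := by
  simp [Algebra.TensorProduct.one_def]

theorem IsCharacter.mul {f g : ConvHom K H A} (hf : IsCharacter f) (hg : IsCharacter g) :
    IsCharacter (f * g) := by
  rw [isCharacter_iff] at *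
  refine ⟨by rw [convMul_apply_one, hf.1, hg.1, one_mul], ?_⟩
  rw [map_mul, hf.2, hg.2, tensorHom_mul]

theorem isCharacter_one : IsCharacter (1 : ConvHom K H A) := by
  rw [isCharacter_iff]
  exact ⟨by simp, by rw [map_one, tensorHom_one_one]⟩

theorem IsCharacter.pow {f : ConvHom K H A} (hf : IsCharacter f) (n : ℕ) :
    IsCharacter (f ^ n) := by
  induction n with
  | zero => rw [pow_zero]; exact isCharacter_one
  | succ n ih => rw [pow_succ]; exact ih.mul hf

theorem IsInfinitesimalCharacter.sub {f g : ConvHom K H A} (hf : IsInfinitesimalCharacter f)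
    (hg : IsInfinitesimalCharacter g) : IsInfinitesimalCharacter (f - g) := by
  intro x y
  simp only [ConvHom.sub_apply, hf x y, hg x y]
  ring

theorem IsInfinitesimalCharacter.neg {f : ConvHom K H A} (hf : IsInfinitesimalCharacter f) :
    IsInfinitesimalCharacter (-f) := by
  intro x y
  simp only [ConvHom.neg_apply, hf x y]
  ring

/-- The counit takes values in `K`, so the Leibniz rule only needs `K`-linearity of `R`. This is why
the argument runs on logarithms instead of on characters. -/
theorem IsInfinitesimalCharacter.postComp {f : ConvHom K H A} (hf : IsInfinitesimalCharacter f)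
    (R : A →ₗ[K] A) : IsInfinitesimalCharacter (postComp H R f) := by
  intro x y
  simp only [postComp_apply, hf x y, map_add]
  rw [mul_comm (f x), mul_comm (R (f x)), ← Algebra.smul_def, ← Algebra.smul_def,
    ← Algebra.smul_def, ← Algebra.smul_def, map_smul, map_smul]

/-- The powers of an infinitesimal character satisfy the Leibniz rule. -/
theorem IsInfinitesimalCharacter.pow_apply_mul {f : ConvHom K H A}
    (hf : IsInfinitesimalCharacter f) (n : ℕ) (x y : H) :
    (f ^ n) (x * y) = ∑ m ∈ Finset.HasAntidiagonal.antidiagonal n,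
      n.choose m.1 • ((f ^ m.1) x * (f ^ m.2) y) := by
  -- The two summands of the pullback of `f` commute, both products being `f ⊗ f`, so the binomial
  -- theorem applies.
  have hc : Commute (tensorHom f 1) (tensorHom 1 f) := by
    rw [commute_iff_eq, tensorHom_mul, tensorHom_mul]
    simp
  rw [← mulPullback_tmul, map_pow, (isInfinitesimalCharacter_iff f).1 hf, add_comm, hc.add_pow']
  rw [WithConv.ofConv_sum, LinearMap.sum_apply]
  refine Finset.sum_congr rfl fun m _ => ?_
  rw [tensorHom_pow, tensorHom_pow, tensorHom_mul, one_pow, one_pow, mul_one, one_mul,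
    ← tensorHom_tmul]
  generalize n.choose m.1 = k
  rw [← Nat.cast_smul_eq_nsmul K, ← Nat.cast_smul_eq_nsmul K]
  rfl

variable {G : ℕ → Submodule K H} [GradedAlgebra G]

theorem isInfinitesimalCharacter_of_isFilLimit {u : ℕ → ConvHom K H A} {L : ConvHom K H A}
    (hu : ∀ n, IsInfinitesimalCharacter (u n)) (h : IsFilLimit (homFil A G) u L) :
    IsInfinitesimalCharacter L := by
  intro x y
  obtain ⟨M, hM⟩ := h.exists_apply_eq x
  obtain ⟨N, hN⟩ := h.exists_apply_eq y
  obtain ⟨P, hP⟩ := h.exists_apply_eq (x * y)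
  rw [← hM (M + N + P) (by omega), ← hN (M + N + P) (by omega), ← hP (M + N + P) (by omega)]
  exact hu _ x y

/-- As `A` may have zero divisors, root counting is done over `K`: apply an arbitrary linear
functional `A → K` to the coefficients. -/
theorem eq_zero_of_forall_eval_natCast [CharZero K] (p : Polynomial A)
    (h : ∀ n : ℕ, p.eval (n : A) = 0) : p = 0 := by
  ext i
  rw [Polynomial.coeff_zero, ← Module.forall_dual_apply_eq_zero_iff K]
  intro f
  let q : Polynomial K := ∑ j ∈ p.support, Polynomial.monomial j (f (p.coeff j))
  have hq : q = 0 := by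
    refine Polynomial.eq_zero_of_infinite_isRoot q
      ((Set.infinite_range_of_injective (Nat.cast_injective (R := K))).mono ?_)
    rintro _ ⟨n, rfl⟩
    have := congrArg f (h n)
    rw [Polynomial.eval_eq_sum, Polynomial.sum, map_sum, map_zero] at this
    simp only [q, Set.mem_ofPred_eq, Polynomial.IsRoot, Polynomial.eval_finsetSum,
      Polynomial.eval_monomial]
    rw [← this]
    refine Finset.sum_congr rfl fun j _ => ?_
    rw [mul_comm (p.coeff j), show (n : A) ^ j = algebraMap K A ((n : K) ^ j) by simp,
      ← Algebra.smul_def, map_smul, smul_eq_mul, mul_comm]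
  have := congrArg (fun r => Polynomial.coeff r i) hq
  simp only [q, Polynomial.finsetSum_coeff, Polynomial.coeff_monomial, Polynomial.coeff_zero,
    Finset.sum_ite_eq', Polynomial.mem_support_iff] at this
  by_cases hi : p.coeff i = 0
  · rw [hi, map_zero]
  · simpa [hi] using this

/-- At a fixed element of `H`, the map `t ↦ exp (t Z)` is polynomial. -/
theorem exists_polynomial_filExp [CharZero K] (hG : IsConnectedGradedBialgebra G)
    {Z : ConvHom K H A} (hZ : Z ∈ homFil A G 1) (x : H) : ∃ p : Polynomial A,
      (∀ n, p.coeff n = ((n.factorial : K)⁻¹) • (Z ^ n) x) ∧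
      ∀ t : K, filExp (homFil A G) (t • Z) x = p.eval (algebraMap K A t) := by
  have hF := isCompleteFiltered_homFil A hG
  -- The cut-off depends on `x` only, so a single polynomial serves every `t`.
  obtain ⟨N, hN⟩ := exists_forall_homFil_apply_eq_zero A (G := G) x
  refine ⟨∑ n ∈ Finset.range N, Polynomial.monomial n (((n.factorial : K)⁻¹) • (Z ^ n) x),
    fun n => ?_, fun t => ?_⟩
  · simp only [Polynomial.finsetSum_coeff, Polynomial.coeff_monomial, Finset.sum_ite_eq',
      Finset.mem_range]
    split_ifs with hn
    · rfl
    · rw [hN n (not_lt.1 hn) _ (hF.pow_mem hZ n), smul_zero]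
  · have h := hF.sum_sub_filEval_mem (PowerSeries.exp K) ((homFil A G 1).smul_mem t hZ) N
    rw [← filExp_eq_filEval] at h
    have h' := hN N le_rfl _ h
    rw [ConvHom.sub_apply, sub_eq_zero] at h'
    rw [← h', ConvHom.sum_apply, Polynomial.eval_finsetSum]
    refine Finset.sum_congr rfl fun n _ => ?_
    rw [Polynomial.eval_monomial, smul_pow, ConvHom.smul_apply, ConvHom.smul_apply,
      PowerSeries.coeff_exp, ← map_pow, mul_comm, ← Algebra.smul_def, smul_comm]
    simp

/-- Dividing the Leibniz rule for powers by `n!` says that the polynomial of `x * y` is the product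
of those of `x` and `y`; evaluate at `t = 1`. -/
theorem IsInfinitesimalCharacter.filExp [CharZero K] (hG : IsConnectedGradedBialgebra G)
    {Z : ConvHom K H A} (hZ : Z ∈ homFil A G 1) (h : IsInfinitesimalCharacter Z) :
    IsCharacter (filExp (homFil A G) Z) := by
  have hF := isCompleteFiltered_homFil A hG
  refine ⟨(sub_one_mem_homFil_iff hG _).1 (hF.filExp_sub_one_mem hZ), fun x y => ?_⟩
  obtain ⟨p, hp, hp'⟩ := exists_polynomial_filExp hG hZ x
  obtain ⟨q, hq, hq'⟩ := exists_polynomial_filExp hG hZ y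
  obtain ⟨r, hr, hr'⟩ := exists_polynomial_filExp hG hZ (x * y)
  have hpq : r = p * q := by
    ext n
    rw [hr, Polynomial.coeff_mul, h.pow_apply_mul, Finset.smul_sum]
    refine Finset.sum_congr rfl fun m hm => ?_
    rw [Finset.HasAntidiagonal.mem_antidiagonal] at hm
    subst hm
    rw [hp, hq, smul_mul_smul_comm, ← Nat.cast_smul_eq_nsmul K, smul_smul]
    congr 1
    have h1 := Nat.add_choose_mul_factorial_mul_factorial m.1 m.2
    rw [← Nat.choose_symm_add] at h1
    have h2 : ((m.1 + m.2).choose m.1 : K) * m.1.factorial * m.2.factorial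
      = (m.1 + m.2).factorial := by exact_mod_cast h1
    have a1 : (m.1.factorial : K) ≠ 0 := by exact_mod_cast m.1.factorial_ne_zero
    have a2 : (m.2.factorial : K) ≠ 0 := by exact_mod_cast m.2.factorial_ne_zero
    have a3 : ((m.1 + m.2).factorial : K) ≠ 0 := by exact_mod_cast (m.1 + m.2).factorial_ne_zero
    field_simp
    linear_combination h2
  have h1 := hr' 1
  have h2 := hp' 1
  have h3 := hq' 1
  rw [one_smul] at h1 h2 h3
  rw [h1, h2, h3, hpq, Polynomial.eval_mul]

/-- At `t = n` the exponential of `t b` is the character `φ ^ n`. The polynomials attached to `x *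
y`, `x`, `y` are therefore multiplicative at all natural numbers, hence identically. -/
theorem IsCharacter.filLog [CharZero K] (hG : IsConnectedGradedBialgebra G)
    {φ : ConvHom K H A} (hφ : IsCharacter φ) :
    IsInfinitesimalCharacter (filLog (homFil A G) φ) := by
  have hF := isCompleteFiltered_homFil A hG
  have hφ1 := (sub_one_mem_homFil_iff hG φ).2 hφ.1
  have hb := hF.filLog_mem hφ1
  have hexp := hF.filExp_filLog hφ1
  set b := RotaBaxterRenorm.filLog (homFil A G) φ
  intro x y
  obtain ⟨p, hp, hp'⟩ := exists_polynomial_filExp hG hb x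
  obtain ⟨q, hq, hq'⟩ := exists_polynomial_filExp hG hb y
  obtain ⟨r, hr, hr'⟩ := exists_polynomial_filExp hG hb (x * y)
  have hpow : ∀ n : ℕ, RotaBaxterRenorm.filExp (homFil A G) ((n : K) • b) = φ ^ n := by
    intro n
    rw [hF.filExp_natCast_smul hb, hexp]
  have hpq : r = p * q := by
    rw [← sub_eq_zero]
    refine eq_zero_of_forall_eval_natCast (K := K) _ fun n => ?_
    have h1 := hr' n
    have h2 := hp' n
    have h3 := hq' n
    rw [hpow, map_natCast] at h1 h2 h3
    rw [Polynomial.eval_sub, Polynomial.eval_mul, ← h1, ← h2, ← h3, (hφ.pow n).2, sub_self]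
  -- The coefficient of `t` is the Leibniz rule for `b`; the constant coefficients are counit
  -- values.
  have h1 := congrArg (fun s => Polynomial.coeff s 1) hpq
  simp only [Polynomial.coeff_mul, Finset.Nat.antidiagonal_succ, Finset.Nat.antidiagonal_zero,
    hp, hq, hr] at h1
  simpa using h1

end Characters

/-! ### Birkhoff decomposition in complete filtered Rota–Baxter algebras -/

section Birkhoff

variable {K B : Type*} [Field K] [Ring B] [Algebra K B] {F : ℕ → Submodule K B} {R : B →ₗ[K] B}

namespace IsCompleteFilteredRotaBaxter

variable (h : IsCompleteFilteredRotaBaxter (1 : K) F R)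
include h

section Chi

variable [CharZero K] {φ c : B} (hc : c ∈ F 1)
  (hφ : φ = filExp F (R c) * filExp F (c - R c))
include hc hφ

theorem filExp_neg_map_mul : filExp F (-R c) * φ = filExp F (c - R c) := by
  rw [hφ, ← mul_assoc, h.completeFiltered.filExp_neg_mul_filExp (h.map_mem 1 c hc), one_mul]

theorem mul_filExp_neg_sub_map : φ * filExp F (-(c - R c)) = filExp F (R c) := by
  rw [hφ, mul_assoc, h.completeFiltered.filExp_mul_filExp_neg (h.sub_map_mem hc), mul_one]

theorem filExp_neg_map_mul_sub_one :
    filExp F (-R c) * (φ - 1) = filExp F (c - R c) - filExp F (-R c) := by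
  rw [mul_sub, mul_one, h.filExp_neg_map_mul hc hφ]

/-- Spitzer's identity at `-c`, up to sign: the argument of `R` is `exp(c - R c) - exp(-R c)`. -/
theorem map_filExp_neg_map_mul_sub_one :
    R (filExp F (-R c) * (φ - 1)) = 1 - filExp F (-R c) := by
  rw [h.filExp_neg_map_mul_sub_one hc hφ, ← neg_sub, map_neg]
  have := h.map_filExp_sub_filExp ((F 1).neg_mem hc)
  rw [map_neg, show -(-c - -R c) = c - R c by abel] at this
  rw [this, neg_sub]

theorem filExp_neg_map_eq : filExp F (-R c) = 1 - R (filExp F (-R c) * (φ - 1)) := by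
  rw [h.map_filExp_neg_map_mul_sub_one hc hφ, sub_sub_self]

/-- Spitzer's identity at `c`: here `(φ - 1) * exp(-(c - R c))` equals `exp(R c) - exp(-(c - R c))`.
-/
theorem filExp_neg_sub_map_eq : filExp F (-(c - R c))
    = 1 - ((φ - 1) * filExp F (-(c - R c)) - R ((φ - 1) * filExp F (-(c - R c)))) := by
  rw [sub_mul, one_mul, h.mul_filExp_neg_sub_map hc hφ, h.sub_map_filExp_sub_filExp hc,
    sub_sub_self]

theorem doubleExp_neg_eq : doubleExp F R (-c) = 1 - filExp F (-R c) * (φ - 1) := by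
  rw [h.doubleExp_eq ((F 1).neg_mem hc), h.filExp_neg_map_mul_sub_one hc hφ, map_neg,
    show -(-c - -R c) = c - R c by abel]
  abel

end Chi

/-- Uniqueness of the Birkhoff decomposition for an idempotent Rota–Baxter map. -/
theorem eq_one_sub_map_of_birkhoff [CharZero K] (hR : ∀ x, R (R x) = R x) {φ ψm ψp : B}
    (hm : ψm ∈ oneAddRange F R) (hp : ψp ∈ oneAddRange F (LinearMap.id - R))
    (hφ : φ = Ring.inverse ψm * ψp) : ψp = ψm * φ ∧ ψm = 1 - R (ψm * (φ - 1)) := by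
  obtain ⟨u, hu, rfl⟩ := hm
  obtain ⟨v, hv, rfl⟩ := hp
  have hunit : IsUnit (1 + R u) := h.completeFiltered.isUnit_of_sub_one_mem (by
    rw [add_sub_cancel_left]; exact h.map_mem 1 u hu)
  have e : 1 + (LinearMap.id - R : B →ₗ[K] B) v = (1 + R u) * φ := by
    rw [hφ, ← mul_assoc, Ring.mul_inverse_cancel _ hunit, one_mul]
  refine ⟨e, ?_⟩
  -- Here `ψm * (φ - 1) = ψp - ψm = (v - R v) - R u`. By idempotence, `R` kills the first part and
  -- fixes `R u`.
  rw [mul_sub, ← e, mul_one, add_sub_add_left_eq_sub, LinearMap.sub_apply, LinearMap.id_apply,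
    map_sub, map_sub, hR, hR]
  abel

end IsCompleteFilteredRotaBaxter

end Birkhoff

/-! ### Rota–Baxter structure and BCH-recursion on infinitesimal characters -/

section HopfRotaBaxter

variable {K H A : Type*} [Field K] [CommRing H] [Bialgebra K H] [CommRing A] [Algebra K A]
  {G : ℕ → Submodule K H} [GradedAlgebra G]

theorem isCompleteFilteredRotaBaxter_postComp (hG : IsConnectedGradedBialgebra G)
    {R : A →ₗ[K] A} (hR : IsRotaBaxter (1 : K) R) :
    IsCompleteFilteredRotaBaxter (1 : K) (homFil A G) (postComp H R) where
  completeFiltered := isCompleteFiltered_homFil A hG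
  rotaBaxter := isRotaBaxter_postComp hR
  map_mem := postComp_mem_homFil G R

theorem IsInfinitesimalCharacter.filBCH [CharZero K] (hG : IsConnectedGradedBialgebra G)
    {X Y : ConvHom K H A} (hX : X ∈ homFil A G 1) (hY : Y ∈ homFil A G 1)
    (hX' : IsInfinitesimalCharacter X) (hY' : IsInfinitesimalCharacter Y) :
    IsInfinitesimalCharacter (filBCH (homFil A G) X Y) :=
  ((((hX'.filExp hG hX).mul (hY'.filExp hG hY)).filLog hG).sub hX').sub hY'

theorem IsInfinitesimalCharacter.chi [CharZero K] (hG : IsConnectedGradedBialgebra G)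
    (R : A →ₗ[K] A) {b : ConvHom K H A} (hb : b ∈ homFil A G 1)
    (hb' : IsInfinitesimalCharacter b) :
    IsInfinitesimalCharacter (chi (homFil A G) (RotaBaxterRenorm.postComp H R) b) := by
  have hF := isCompleteFiltered_homFil A hG
  have hP := postComp_mem_homFil G R
  refine isInfinitesimalCharacter_of_isFilLimit (fun n => ?_) (hF.isFilLimit_chi hP hb)
  induction n with
  | zero => exact hb'
  | succ n ih =>
    have hn := hF.chiApprox_mem hP hb n
    exact hb'.sub (IsInfinitesimalCharacter.filBCH hG (hP 1 _ hn)
      ((homFil A G 1).sub_mem hn (hP 1 _ hn)) (ih.postComp R) (ih.sub (ih.postComp R)))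

theorem postComp_one_apply_of_counit_eq_zero (R : A →ₗ[K] A) {x : H}
    (hx : Coalgebra.counit (R := K) x = 0) : postComp H R 1 x = 0 := by
  rw [postComp_apply, LinearMap.convOne_apply, hx, map_zero, map_zero]

theorem postComp_one (R : A →ₗ[K] A) (hR : R 1 = 0) : postComp H R 1 = 0 := by
  ext x
  rw [postComp_apply, LinearMap.convOne_apply, Algebra.algebraMap_eq_smul_one, map_smul, hR,
    smul_zero]
  rfl

end HopfRotaBaxter

end RotaBaxterRenorm

end

/-! ### Birkhoff decomposition of characters and Bogoliubov's map -/

open RotaBaxterRenorm in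
theorem theorem4p1 {K H A : Type*} [Field K] [CharZero K]
    [CommRing H] [Bialgebra K H] (G : ℕ → Submodule K H) [GradedAlgebra G]
    (hG : IsConnectedGradedBialgebra G)
    [CommRing A] [Algebra K A] (R : A →ₗ[K] A)
    (hRB : IsRotaBaxter (1 : K) R) (hR : ∀ x, R (R x) = R x)
    (Rt : A →ₗ[K] A) (hRt : Rt = LinearMap.id - R)
    (F : ℕ → Submodule K (ConvHom K H A)) (hF : F = homFil A G)
    (cR : ConvHom K H A →ₗ[K] ConvHom K H A) (hcR : cR = postComp H R)
    (cRt : ConvHom K H A →ₗ[K] ConvHom K H A) (hcRt : cRt = LinearMap.id - cR) :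
    -- the complete filtered Rota–Baxter algebra `Hom(H, A)`
    IsCompleteFilteredRotaBaxter (1 : K) F cR ∧ (∀ f, cR (cR f) = cR f) ∧
    ∀ φ a b c : ConvHom K H A, IsCharacter φ →
      a = φ - 1 → b = filLog F φ → c = chi F cR b →
      -- `φ = exp(b)` for a unique `b`, which is an infinitesimal character
      a ∈ F 1 ∧ IsUnit φ ∧
      (b ∈ F 1 ∧ IsInfinitesimalCharacter b ∧ filExp F b = φ ∧
        ∀ b' ∈ F 1, filExp F b' = φ → b' = b) ∧
      -- the BCH-recursion converges
      (c ∈ F 1 ∧ IsFilLimit F (chiApprox F cR b) c ∧ c = b - filBCH F (cR c) (cRt c)) ∧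
      ∃ φm φp Y : ConvHom K H A,
        -- (1) Atkinson's recursions and their solutions
        ((φm = 1 - cR (φm * a) ∧ ∀ X, X = 1 - cR (X * a) → X = φm) ∧
          (Y = 1 - cRt (a * Y) ∧ ∀ Y', Y' = 1 - cRt (a * Y') → Y' = Y) ∧
          Y * φp = 1 ∧ φp * Y = 1 ∧ IsCharacter Y ∧
          φp = 1 - cRt (φp * (Ring.inverse φ - 1)) ∧
          φp = φm * φ ∧
          (∀ Γ : H, Coalgebra.counit (R := K) Γ = 0 →
            φm Γ = -R (barMap φm φ Γ) ∧ φp Γ = Rt (barMap φm φ Γ)) ∧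
          ∀ (ι : Type) (s : Finset ι) (γ ρ : ι → H) (Γ : H),
            Coalgebra.counit (R := K) Γ = 0 →
            (Coalgebra.comul Γ : TensorProduct K H H) =
              TensorProduct.tmul K Γ 1 + TensorProduct.tmul K 1 Γ
                + ∑ i ∈ s, TensorProduct.tmul K (γ i) (ρ i) →
            φm Γ = -R (φ Γ + ∑ i ∈ s, φm (γ i) * φ (ρ i)) ∧
            φp Γ = Rt (φ Γ + ∑ i ∈ s, φm (γ i) * φ (ρ i))) ∧
        -- (2) Spitzer's identity and the exponential formulae
        (IsFilLimit F (fun N => ∑ n ∈ Finset.range N, (-1) ^ n * leftIter cR a n) φm ∧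
          IsFilLimit F (fun N => ∑ n ∈ Finset.range N, (-1) ^ n * rightIter cRt a n) Y ∧
          φm = filExp F (-cR c) ∧ φp = filExp F (cRt c) ∧ Y = filExp F (-cRt c) ∧
          IsCharacter φm ∧ IsCharacter φp ∧
          φm ∈ oneAddRange F cR ∧ φp ∈ oneAddRange F cRt) ∧
        -- (3) the unique Birkhoff decomposition
        (IsUnit φm ∧ φ = Ring.inverse φm * φp ∧
          Ring.inverse φm = filExp F (cR c) ∧ φ = filExp F (cR c) * filExp F (cRt c) ∧
          ∀ ψm ∈ oneAddRange F cR, ∀ ψp ∈ oneAddRange F cRt,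
            φ = Ring.inverse ψm * ψp → ψm = φm ∧ ψp = φp) ∧
        -- (4) Bogoliubov's preparation map
        (barMap φm φ = φm * (φ - 1) ∧
          barMap φm φ = 1 - doubleExp F cR (-c) ∧
          (∀ Γ : H, Coalgebra.counit (R := K) Γ = 0 →
            barMap φm φ Γ = -(doubleExp F cR (-c) Γ) ∧
            cR (doubleExp F cR (-c)) Γ = (φm - 1) Γ ∧
            cRt (doubleExp F cR (-c)) Γ = (2 - φp) Γ) ∧
          cR (barMap φm φ) = 1 - φm ∧ cRt (barMap φm φ) = φp - 1 ∧
          (R 1 = 0 → cR (doubleExp F cR (-c)) = φm - 1 ∧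
            cRt (doubleExp F cR (-c)) = 2 - φp)) := by
  subst hRt hF hcR hcRt
  have hB := isCompleteFilteredRotaBaxter_postComp (A := A) hG hRB
  have hF := hB.completeFiltered
  have hcR2 : ∀ f, postComp H R (postComp H R f) = postComp H R f := by
    intro f
    ext x
    exact hR _
  refine ⟨hB, hcR2, ?_⟩
  rintro φ a b c hφ rfl hb hc
  have ha : φ - 1 ∈ homFil A G 1 := (sub_one_mem_homFil_iff hG φ).2 hφ.1
  have hb1 : b ∈ homFil A G 1 := hb ▸ hF.filLog_mem ha
  have hb2 : IsInfinitesimalCharacter b := hb ▸ hφ.filLog hG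
  have hbφ : filExp (homFil A G) b = φ := hb ▸ hF.filExp_filLog ha
  have hc1 : c ∈ homFil A G 1 := hc ▸ hF.chi_mem hB.map_mem hb1
  have hc2 : IsInfinitesimalCharacter c := hc ▸ hb2.chi hG R hb1
  have hRc1 := hB.map_mem 1 c hc1
  have hRtc1 := hB.sub_map_mem hc1
  have hRc2 := hc2.postComp R
  have hRtc2 := hc2.sub hRc2
  have hfac : φ = filExp (homFil A G) (postComp H R c)
      * filExp (homFil A G) (c - postComp H R c) := by
    rw [← hbφ, hc]
    exact hF.filExp_eq_mul_filExp_chi hB.map_mem hb1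
  have hmem' : ∀ n x, x ∈ homFil A G n →
      (LinearMap.id - postComp H R : ConvHom K H A →ₗ[K] ConvHom K H A) x ∈ homFil A G n :=
    fun n x hx => hB.sub_map_mem hx
  have hm_char := hRc2.neg.filExp hG ((homFil A G 1).neg_mem hRc1)
  have hp_char := hRtc2.filExp hG hRtc1
  have hY_char := hRtc2.neg.filExp hG ((homFil A G 1).neg_mem hRtc1)
  have hm_eq := hB.filExp_neg_map_eq hc1 hfac
  have hY_eq := hB.filExp_neg_sub_map_eq hc1 hfac
  have hmφ := hB.filExp_neg_map_mul hc1 hfac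
  have hbar_eq := barMap_eq _ φ hm_char.1 hφ.1
  have hbar_exp := hB.doubleExp_neg_eq hc1 hfac
  have hRbar := hB.map_filExp_neg_map_mul_sub_one hc1 hfac
  have hinv_m := hF.inverse_filExp ((homFil A G 1).neg_mem hRc1)
  rw [neg_neg] at hinv_m
  have hYp := hF.filExp_neg_mul_filExp hRtc1
  have hpY := hF.filExp_mul_filExp_neg hRtc1
  have hm_unit := hF.isUnit_filExp ((homFil A G 1).neg_mem hRc1)
  have hφ_unit : IsUnit φ := hF.isUnit_of_sub_one_mem ha
  simp only [LinearMap.sub_apply, LinearMap.id_apply] at *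
  set φm := filExp (homFil A G) (-postComp H R c)
  set φp := filExp (homFil A G) (c - postComp H R c)
  set Y := filExp (homFil A G) (-(c - postComp H R c))
  have hRtbar : φm * (φ - 1) - postComp H R (φm * (φ - 1)) = φp - 1 := by
    rw [hRbar, mul_sub, mul_one, hmφ]
    abel
  have hm_apply : ∀ Γ : H, Coalgebra.counit (R := K) Γ = 0 → φm Γ = -R (barMap φm φ Γ) := by
    intro Γ hΓ
    have := congrArg (fun f : ConvHom K H A => f Γ) hRbar
    simp only [postComp_apply, ConvHom.sub_apply, LinearMap.convOne_apply, hΓ, map_zero] at this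
    rw [hbar_eq, this]
    ring
  have hp_apply : ∀ Γ : H, Coalgebra.counit (R := K) Γ = 0 →
      φp Γ = barMap φm φ Γ - R (barMap φm φ Γ) := by
    intro Γ hΓ
    have := congrArg (fun f : ConvHom K H A => f Γ) hRtbar
    simp only [postComp_apply, ConvHom.sub_apply, LinearMap.convOne_apply, hΓ, map_zero] at this
    rw [hbar_eq, this, sub_zero]
  refine ⟨ha, hφ_unit, ⟨hb1, hb2, hbφ, fun b' hb' h => hF.filExp_injOn hb' hb1 (h.trans hbφ.symm)⟩,
    ⟨hc1, hc ▸ hF.isFilLimit_chi hB.map_mem hb1, ?_⟩, φm, φp, Y, ?_, ?_, ?_, ?_⟩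
  · have := hF.chi_eq hB.map_mem hb1
    rwa [← hc] at this
  · refine ⟨⟨hm_eq, fun X hX => hF.eq_of_eq_one_sub_map_mul_right hB.map_mem ha hX hm_eq⟩,
      ⟨hY_eq, fun Y' hY' => hF.eq_of_eq_one_sub_map_mul_left
        (R := LinearMap.id - postComp H R) hmem' ha hY' hY_eq⟩,
      hYp, hpY, hY_char, ?_, hmφ.symm, fun Γ hΓ => ⟨hm_apply Γ hΓ, hp_apply Γ hΓ⟩, ?_⟩
    -- Since `φp = φm * φ`, both sides equal `φm - φp`, so the equation for `φp` reduces to the one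
    -- for Bogoliubov's map.
    · have e : φp * (Ring.inverse φ - 1) = -(φm * (φ - 1)) := by
        rw [mul_sub, ← hmφ, mul_assoc, Ring.mul_inverse_cancel _ hφ_unit]
        noncomm_ring
      rw [e, map_neg, ← neg_sub', hRtbar]
      abel
    · intro ι s γ ρ Γ hΓ hΔ
      rw [← barMap_apply_of_comul_eq φm φ s γ ρ Γ hΔ]
      exact ⟨hm_apply Γ hΓ, hp_apply Γ hΓ⟩
  · refine ⟨hF.isFilLimit_leftIter hB.map_mem ha hm_eq,
      hF.isFilLimit_rightIter (R := LinearMap.id - postComp H R) hmem' ha hY_eq, rfl, rfl, rfl,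
      hm_char, hp_char, ?_, ?_⟩
    · refine ⟨-(φm * (φ - 1)), (homFil A G 1).neg_mem (hF.mul_mem_left _ ha), ?_⟩
      rw [map_neg, hRbar]
      abel
    · refine ⟨φm * (φ - 1), hF.mul_mem_left _ ha, ?_⟩
      rw [LinearMap.sub_apply, LinearMap.id_apply, hRtbar]
      abel
  · refine ⟨hm_unit, ?_, hinv_m, hfac, fun ψm hψm ψp hψp h => ?_⟩
    · rw [hinv_m, hfac]
    · obtain ⟨h1, h2⟩ := hB.eq_one_sub_map_of_birkhoff hcR2 hψm hψp h
      have h3 := hF.eq_of_eq_one_sub_map_mul_right hB.map_mem ha h2 hm_eq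
      exact ⟨h3, by rw [h1, h3, hmφ]⟩
  · refine ⟨hbar_eq, ?_, fun Γ hΓ => ⟨?_, ?_, ?_⟩, ?_, ?_, fun hR1 => ⟨?_, ?_⟩⟩
    · rw [hbar_eq, hbar_exp, sub_sub_self]
    · rw [hbar_eq, hbar_exp, ConvHom.sub_apply, LinearMap.convOne_apply, hΓ, map_zero, zero_sub,
        neg_neg]
    -- The unit in the double exponential contributes `R 1` times the counit. It vanishes on the
    -- kernel of the counit, and everywhere only under the extra hypothesis `R 1 = 0` used below.
    · rw [hbar_exp, map_sub, hRbar, ConvHom.sub_apply, postComp_one_apply_of_counit_eq_zero R hΓ,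
        ConvHom.sub_apply, ConvHom.sub_apply]
      ring
    · rw [hbar_exp, map_sub, sub_sub_sub_comm, hRtbar, ← one_add_one_eq_two]
      simp only [ConvHom.sub_apply, ConvHom.add_apply, postComp_one_apply_of_counit_eq_zero R hΓ,
        LinearMap.convOne_apply, hΓ, map_zero]
      ring
    · rw [hbar_eq, hRbar]
    · rw [hbar_eq, hRtbar]
    · rw [hbar_exp, map_sub, hRbar, postComp_one R hR1]
      abel
    · rw [hbar_exp, map_sub, sub_sub_sub_comm, hRtbar, postComp_one R hR1, ← one_add_one_eq_two]
      abel
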